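/- All Lie algebras are over $\mathbb{C}$; in each multiplication table below the products of basis elements not listed, and not obtained from listed ones by antisymmetry, are zero, and the same convention is used for the alternating bilinear maps $\varphi$. Consider the following solvable Lie algebras with basis $e_1,\dots,e_n,x$ (where $n=7,9,11$ in the last three cases). * $R(g^3_{(n,1)},1)$, for any $n\ge 7$: $[e_1,e_i]=e_{i+1}$ $(2\le i\le n-2)$; $[e_i,e_n]=e_{i+2}$ $(2\le i\le n-3)$; $[e_2,e_i]=e_{i+3}$ $(3\le i\le n-4)$; $[e_1,x]=e_1$; $[e_i,x]=(i+1)e_i$ $(2\le i\le n-1)$; $[e_n,x]=2e_n$. * $R(g^1_7,1)$: $[e_1,e_i]=e_{i+1}$ $(2\le i\le 5)$; $[e_2,e_i]=e_{i+2}$ $(i=3,4)$; $[e_i,e_{7-i}]=(-1)^ie_7$ $(i=2,3)$; $[e_i,x]=ie_i$ $(1\le i\le 7)$. * $R(g^2_9,1)$: $[e_1,e_i]=e_{i+1}$ $(2\le i\le 7)$; $[e_2,e_i]=e_{i+2}$ $(i=3,4)$; $[e_2,e_5]=3e_7$; $[e_2,e_6]=5e_8$; $[e_3,e_i]=-2e_{i+3}$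 $(i=4,5)$; $[e_i,e_{9-i}]=(-1)^ie_9$ $(2\le i\le 4)$; $[e_i,x]=ie_i$ $(1\le i\le 9)$. * $R(g^3_{11},1)$: $[e_1,e_i]=e_{i+1}$ $(2\le i\le 9)$; $[e_2,e_i]=e_{i+2}$ $(i=3,4)$; $[e_2,e_i]=-e_{i+2}$ $(i=6,7)$; $[e_3,e_7]=-e_{10}$; $[e_3,e_i]=e_{i+3}$ $(i=4,5)$; $[e_4,e_i]=e_{i+4}$ $(i=5,6)$; $[e_i,e_{11-i}]=(-1)^ie_{11}$ $(2\le i\le 5)$; $[e_i,x]=ie_i$ $(1\le i\le 11)$. **Theorem.** Let $R$ be a Lie algebra isomorphic to one of these algebras. Then the second Lie algebra cohomology space of $R$ with coefficients in the adjoint module has dimension $\dim H^2(R,R)=1$. Moreover, for each of the listed algebras the alternating bilinear map $\varphi$ below is a $2$-cocycle that is not a coboundary, so its class spans $H^2(R,R)$: * for $R(g^3_{(n,1)},1)$: $\varphi(e_1,e_n)=e_2$; $\varphi(e_i,e_n)=(i-3)e_{i+2}$ $(4\le i\le n-3)$; $\varphi(e_2,e_i)=\tfrac32(i-4)e_{i+3}$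 $(5\le i\le n-4)$; $\varphi(e_3,e_i)=-\tfrac32e_{i+4}$ $(4\le i\le n-5)$; * for $R(g^1_7,1)$: $\varphi(e_1,e_6)=e_7$, $\varphi(e_3,e_4)=e_7$; * for $R(g^2_9,1)$: $\varphi(e_1,e_2)=-9e_3$, $\varphi(e_1,e_8)=e_9$, $\varphi(e_2,e_5)=-12e_7$, $\varphi(e_2,e_6)=-24e_8$, $\varphi(e_2,e_7)=-9e_9$, $\varphi(e_3,e_4)=-6e_7$, $\varphi(e_3,e_5)=-6e_8$, $\varphi(e_3,e_6)=5e_9$, $\varphi(e_4,e_5)=-7e_9$; * for $R(g^3_{11},1)$: $\varphi(e_1,e_{10})=e_{11}$, $\varphi(e_2,e_5)=\tfrac34e_7$, $\varphi(e_2,e_6)=\tfrac32e_8$, $\varphi(e_2,e_7)=e_9$, $\varphi(e_2,e_8)=-\tfrac34e_{10}$, $\varphi(e_3,e_4)=-\tfrac34e_7$, $\varphi(e_3,e_5)=-\tfrac34e_8$, $\varphi(e_3,e_6)=\tfrac12e_9$, $\varphi(e_3,e_7)=\tfrac74e_{10}$, $\varphi(e_4,e_5)=-\tfrac54e_9$,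 $\varphi(e_4,e_6)=-\tfrac54e_{10}$, $\varphi(e_4,e_7)=-e_{11}$, $\varphi(e_5,e_6)=2e_{11}$. -/

import Mathlib

open LieModule.Cohomology

noncomputable section

/-- The space `Z²(L, M)` of Chevalley--Eilenberg `2`-cocycles, as a vector space in its own right. -/
def LieZ2 (K L M : Type*) [CommRing K] [LieRing L] [LieAlgebra K L]
    [AddCommGroup M] [Module K M] [LieRingModule L M] [LieModule K L M] : Type _ :=
  twoCocycle K L M

section

variable (K L M : Type*) [CommRing K] [LieRing L] [LieAlgebra K L]
    [AddCommGroup M] [Module K M] [LieRingModule L M] [LieModule K L M]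

instance : AddCommGroup (LieZ2 K L M) :=
  @Submodule.addCommGroup K (twoCochain K L M) _ (Submodule.addCommGroup _) _ (twoCocycle K L M)

instance : Module K (LieZ2 K L M) := Submodule.module (twoCocycle K L M)

/-- The coboundary operator from `1`-cochains to `2`-cocycles. -/
def lieD12 : oneCochain K L M →ₗ[K] LieZ2 K L M :=
  (d₁₂ K L M).codRestrict (twoCocycle K L M) fun f =>
    (mem_twoCocycle_iff K L M _).2 (LinearMap.congr_fun (d₂₃_comp_d₁₂ K L M) f)

/-- The second Chevalley--Eilenberg cohomology space `H²(L, M) = Z²(L, M) / B²(L, M)`. -/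
abbrev LieH2 : Type _ := LieZ2 K L M ⧸ LinearMap.range (lieD12 K L M)

end

/-- The vector `v_k` of the standard basis `v_0, …, v_n` of `ℂ^{n+1}`; it is `0` for `k > n`. -/
def stdVec (n k : ℕ) : Fin (n + 1) → ℂ :=
  if hk : k < n + 1 then Pi.single ⟨k, hk⟩ 1 else 0

/-- The bilinear map on `ℂ^{n+1}` with `(v_i, v_j) ↦ c i j • v_{i+j}`. -/
def gradedBilin (n : ℕ) (c : ℕ → ℕ → ℂ) :
    (Fin (n + 1) → ℂ) →ₗ[ℂ] (Fin (n + 1) → ℂ) →ₗ[ℂ] (Fin (n + 1) → ℂ) :=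
  (Pi.basisFun ℂ (Fin (n + 1))).constr ℂ fun i =>
    (Pi.basisFun ℂ (Fin (n + 1))).constr ℂ fun j => c i j • stdVec n (i + j)

theorem stdVec_of_lt {n k : ℕ} (hk : n < k) : stdVec n k = 0 := by
  simp [stdVec]; omega

theorem stdVec_fin {n : ℕ} (i : Fin (n + 1)) :
    stdVec n i = Pi.basisFun ℂ (Fin (n + 1)) i := by
  simp only [stdVec, dif_pos i.2, Pi.basisFun_apply]

theorem gradedBilin_stdVec (n : ℕ) (c : ℕ → ℕ → ℂ) (i j : ℕ) :
    gradedBilin n c (stdVec n i) (stdVec n j) = c i j • stdVec n (i + j) := by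
  by_cases hi : i < n + 1
  · by_cases hj : j < n + 1
    · have h1 := stdVec_fin (⟨i, hi⟩ : Fin (n + 1))
      have h2 := stdVec_fin (⟨j, hj⟩ : Fin (n + 1))
      simp only at h1 h2
      rw [h1, h2, gradedBilin, Module.Basis.constr_basis, Module.Basis.constr_basis]
    · rw [stdVec_of_lt (k := j) (by omega), stdVec_of_lt (k := i + j) (by omega)]
      simp
  · rw [stdVec_of_lt (k := i) (by omega), stdVec_of_lt (k := i + j) (by omega)]
    simp

theorem gradedBilin_skew (n : ℕ) (c : ℕ → ℕ → ℂ) (hc : ∀ i j, c i j = -c j i)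
    (u w : Fin (n + 1) → ℂ) : gradedBilin n c u w = -gradedBilin n c w u := by
  have h : gradedBilin n c = -(gradedBilin n c).flip := by
    refine (Pi.basisFun ℂ (Fin (n + 1))).ext fun i =>
      (Pi.basisFun ℂ (Fin (n + 1))).ext fun j => ?_
    simp only [LinearMap.neg_apply, LinearMap.flip_apply]
    rw [← stdVec_fin, ← stdVec_fin, gradedBilin_stdVec, gradedBilin_stdVec, hc,
      add_comm (i : ℕ) (j : ℕ), neg_smul]
  exact congrArg (fun B => B u w) h

theorem gradedBilin_self (n : ℕ) (c : ℕ → ℕ → ℂ) (hc : ∀ i j, c i j = -c j i)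
    (u : Fin (n + 1) → ℂ) : gradedBilin n c u u = 0 := by
  have h := gradedBilin_skew n c hc u u
  rwa [eq_neg_iff_add_eq_zero, ← two_smul ℂ, smul_eq_zero_iff_right two_ne_zero] at h

/-- A multiplication table for a Lie algebra with basis `v_0, …, v_n` graded by the index:
`half i j` is the coefficient of `v_{i+j}` contributed by a product `[v_i, v_j]` in the list of
nonzero products (each listed once), where `v_k = 0` for `k > n`. The products `[v_j, v_i]` are
then given by antisymmetry, and products that are not listed vanish. -/
structure GradedTable where
  n : ℕ
  half : ℕ → ℕ → ℤ
  jacobi : ∀ i < n + 1, ∀ j < n + 1, ∀ k < n + 1, i + j + k ≤ n →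
    (half j k - half k j) * (half i (j + k) - half (j + k) i) +
    (half k i - half i k) * (half j (k + i) - half (k + i) j) +
    (half i j - half j i) * (half k (i + j) - half (i + j) k) = 0

namespace GradedTable

/-- The antisymmetrized structure constants: `[v_i, v_j] = coeff i j • v_{i+j}`. -/
def coeff (T : GradedTable) (i j : ℕ) : ℂ := ((T.half i j - T.half j i : ℤ) : ℂ)

/-- The complex Lie algebra with multiplication table `T`. -/
def Alg (T : GradedTable) : Type := Fin (T.n + 1) → ℂ

instance (T : GradedTable) : AddCommGroup T.Alg :=
  inferInstanceAs (AddCommGroup (Fin (T.n + 1) → ℂ))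

instance (T : GradedTable) : Module ℂ T.Alg :=
  inferInstanceAs (Module ℂ (Fin (T.n + 1) → ℂ))

/-- The basis vector `v_k` (zero for `k > n`). -/
def v (T : GradedTable) (k : ℕ) : T.Alg := stdVec T.n k

/-- The bilinear map with `(v_i, v_j) ↦ c i j • v_{i+j}`. -/
def bilin (T : GradedTable) (c : ℕ → ℕ → ℂ) : T.Alg →ₗ[ℂ] T.Alg →ₗ[ℂ] T.Alg :=
  gradedBilin T.n c

theorem bilin_v (T : GradedTable) (c : ℕ → ℕ → ℂ) (i j : ℕ) :
    T.bilin c (T.v i) (T.v j) = c i j • T.v (i + j) := gradedBilin_stdVec _ _ _ _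

theorem coeff_skew (T : GradedTable) (i j : ℕ) : T.coeff i j = -T.coeff j i := by
  simp [coeff]

theorem coeff_jacobi (T : GradedTable) (i j k : Fin (T.n + 1)) (h : (i + j + k : ℕ) ≤ T.n) :
    T.coeff j k * T.coeff i (j + k) =
      T.coeff i j * T.coeff (i + j) k + T.coeff i k * T.coeff j (i + k) := by
  have h1 := T.jacobi i i.2 j j.2 k k.2 h
  have h2 := congrArg (Int.cast : ℤ → ℂ) h1
  rw [add_comm (k : ℕ) i] at h2
  simp only [coeff]
  push_cast at h2 ⊢
  linear_combination h2

theorem bilin_leibniz (T : GradedTable) (a b d : T.Alg) :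
    T.bilin T.coeff a (T.bilin T.coeff b d) =
      T.bilin T.coeff (T.bilin T.coeff a b) d + T.bilin T.coeff b (T.bilin T.coeff a d) := by
  let B := T.bilin T.coeff
  let e : Module.Basis (Fin (T.n + 1)) ℂ T.Alg := Pi.basisFun ℂ (Fin (T.n + 1))
  have he : ∀ i, e i = T.v i := fun i => (stdVec_fin i).symm
  have key : ∀ i j k : Fin (T.n + 1), B (e i) (B (e j) (e k)) =
      B (B (e i) (e j)) (e k) + B (e j) (B (e i) (e k)) := by
    intro i j k
    simp only [B, he, bilin_v, map_smul, LinearMap.smul_apply, smul_smul]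
    have e1 : (j : ℕ) + (i + k) = i + (j + k) := by omega
    have e2 : (i : ℕ) + j + k = i + (j + k) := by omega
    rw [e1, e2, ← add_smul]
    by_cases h : (i + j + k : ℕ) ≤ T.n
    · rw [coeff_jacobi T i j k h]
    · have : T.v (i + (j + k)) = 0 := stdVec_of_lt (by omega)
      rw [this, smul_zero, smul_zero]
  have h1 : ∀ i j : Fin (T.n + 1), B (e i) (B (e j) d) =
      B (B (e i) (e j)) d + B (e j) (B (e i) d) := by
    intro i j
    have : (B (e i)).comp (B (e j)) = B (B (e i) (e j)) + (B (e j)).comp (B (e i)) :=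
      e.ext fun k => key i j k
    exact congrArg (fun F => F d) this
  have h2 : ∀ i : Fin (T.n + 1), B (e i) (B b d) = B (B (e i) b) d + B b (B (e i) d) := by
    intro i
    have : (B (e i)).comp (B.flip d) = (B.flip d).comp (B (e i)) + B.flip (B (e i) d) :=
      e.ext fun j => h1 i j
    exact congrArg (fun F => F b) this
  have : B.flip (B b d) = (B.flip d).comp (B.flip b) + (B b).comp (B.flip d) :=
    e.ext fun i => h2 i
  exact congrArg (fun F => F a) this

instance (T : GradedTable) : LieRing T.Alg where
  bracket a b := T.bilin T.coeff a b
  add_lie a b d := by simp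
  lie_add a b d := by simp
  lie_self a := gradedBilin_self T.n _ T.coeff_skew a
  leibniz_lie a b d := T.bilin_leibniz a b d

instance (T : GradedTable) : LieAlgebra ℂ T.Alg where
  lie_smul t a b := map_smul (T.bilin T.coeff a) t b

theorem lie_v (T : GradedTable) (i j : ℕ) : ⁅T.v i, T.v j⁆ = T.coeff i j • T.v (i + j) :=
  T.bilin_v _ i j

/-- The alternating bilinear map whose list of nonzero values is
`(v_i, v_j) ↦ p i j • v_{i+j}` (each unordered pair listed once). -/
def cochain (T : GradedTable) (p : ℕ → ℕ → ℚ) : twoCochain ℂ T.Alg T.Alg :=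
  ⟨T.bilin fun i j => ((p i j - p j i : ℚ) : ℂ),
    fun a => gradedBilin_self T.n _ (fun i j => by simp) a⟩

theorem cochain_v (T : GradedTable) (p : ℕ → ℕ → ℚ) (i j : ℕ) :
    T.cochain p (T.v i) (T.v j) = ((p i j - p j i : ℚ) : ℂ) • T.v (i + j) :=
  T.bilin_v (fun i j => ((p i j - p j i : ℚ) : ℂ)) i j

end GradedTable

/-! In each of the following tables `v_0` is the element `x` of the complement of the nilradical. -/

set_option maxHeartbeats 4000000 in
/-- The algebra `R(g³_{(n,1)}, 1)` with basis `e_1, …, e_n, x`. The grading index of `x` is `0`,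
that of `e_1` is `1`, that of `e_n` is `2`, and that of `e_i` is `i + 1` for `2 ≤ i ≤ n - 1`. The
upper bounds on indices in the multiplication table come from `v_k = 0` for `k > n`; the table in
terms of the `e_i` is spelled out in the lemmas below. -/
def Rg3 (n : ℕ) : GradedTable where
  n := n
  half i j :=
    if j = 0 then i
    else if i = 1 ∧ 3 ≤ j then 1
    else if 3 ≤ i ∧ j = 2 then 1
    else if i = 3 ∧ 4 ≤ j then 1
    else 0
  jacobi := by
    intro i _ j _ k _ _
    have e : ∀ i : ℕ, i = 0 ∨ i = 1 ∨ i = 2 ∨ i = 3 ∨ ∃ m, i = m + 4 := fun i => by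
      rcases i with _ | _ | _ | _ | i <;> simp
    obtain rfl | rfl | rfl | rfl | ⟨i, rfl⟩ := e i <;>
    obtain rfl | rfl | rfl | rfl | ⟨j, rfl⟩ := e j <;>
    obtain rfl | rfl | rfl | rfl | ⟨k, rfl⟩ := e k <;>
    simp <;> (try split_ifs) <;> (try omega) <;> (try ring_nf)

/-- The algebra `R(g¹_7, 1)`; here `v_i = e_i` for `1 ≤ i ≤ 7`. -/
def Rg7 : GradedTable where
  n := 7
  half i j :=
    if j = 0 then i
    else if i = 1 ∧ 2 ≤ j ∧ j ≤ 5 then 1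
    else if i = 2 ∧ 3 ≤ j ∧ j ≤ 4 then 1
    else if 2 ≤ i ∧ i ≤ 3 ∧ i + j = 7 then (-1) ^ i
    else 0
  jacobi := by decide +kernel

/-- The algebra `R(g²_9, 1)`; here `v_i = e_i` for `1 ≤ i ≤ 9`. -/
def Rg9 : GradedTable where
  n := 9
  half i j :=
    if j = 0 then i
    else if i = 1 ∧ 2 ≤ j ∧ j ≤ 7 then 1
    else if i = 2 ∧ 3 ≤ j ∧ j ≤ 4 then 1
    else if i = 2 ∧ j = 5 then 3
    else if i = 2 ∧ j = 6 then 5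
    else if i = 3 ∧ 4 ≤ j ∧ j ≤ 5 then -2
    else if 2 ≤ i ∧ i ≤ 4 ∧ i + j = 9 then (-1) ^ i
    else 0
  jacobi := by decide +kernel

/-- The algebra `R(g³_11, 1)`; here `v_i = e_i` for `1 ≤ i ≤ 11`. -/
def Rg11 : GradedTable where
  n := 11
  half i j :=
    if j = 0 then i
    else if i = 1 ∧ 2 ≤ j ∧ j ≤ 9 then 1
    else if i = 2 ∧ 3 ≤ j ∧ j ≤ 4 then 1
    else if i = 2 ∧ 6 ≤ j ∧ j ≤ 7 then -1
    else if i = 3 ∧ j = 7 then -1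
    else if i = 3 ∧ 4 ≤ j ∧ j ≤ 5 then 1
    else if i = 4 ∧ 5 ≤ j ∧ j ≤ 6 then 1
    else if 2 ≤ i ∧ i ≤ 5 ∧ i + j = 11 then (-1) ^ i
    else 0
  jacobi := by decide +kernel

/-- The grading index of `e_i` in `R(g³_{(n,1)}, 1)`. -/
def rg3Weight (n i : ℕ) : ℕ := if i = 1 then 1 else if i = n then 2 else i + 1

/-- The basis vector `e_i` of `R(g³_{(n,1)}, 1)`, for `1 ≤ i ≤ n`. -/
def rg3E (n i : ℕ) : (Rg3 n).Alg := (Rg3 n).v (rg3Weight n i)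

/-- The list of nonzero values of the cochain on `R(g³_{(n,1)}, 1)`, in terms of grading
indices; the values on the `e_i` are spelled out in the lemma `rg3Cochain_e` below. -/
def rg3Values (i j : ℕ) : ℚ :=
  if i = 1 ∧ j = 2 then 1
  else if 5 ≤ i ∧ j = 2 then i - 4
  else if i = 3 ∧ 6 ≤ j then 3 / 2 * (j - 5)
  else if i = 4 ∧ 5 ≤ j then -3 / 2
  else 0

/-- The list of nonzero values of the cochain on `R(g¹_7, 1)`. -/
def rg7Values : ℕ → ℕ → ℚ
  | 1, 6 => 1
  | 3, 4 => 1
  | _, _ => 0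

/-- The list of nonzero values of the cochain on `R(g²_9, 1)`. -/
def rg9Values : ℕ → ℕ → ℚ
  | 1, 2 => -9
  | 1, 8 => 1
  | 2, 5 => -12
  | 2, 6 => -24
  | 2, 7 => -9
  | 3, 4 => -6
  | 3, 5 => -6
  | 3, 6 => 5
  | 4, 5 => -7
  | _, _ => 0

/-- The list of nonzero values of the cochain on `R(g³_11, 1)`. -/
def rg11Values : ℕ → ℕ → ℚ
  | 1, 10 => 1
  | 2, 5 => 3 / 4
  | 2, 6 => 3 / 2
  | 2, 7 => 1
  | 2, 8 => -3 / 4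
  | 3, 4 => -3 / 4
  | 3, 5 => -3 / 4
  | 3, 6 => 1 / 2
  | 3, 7 => 7 / 4
  | 4, 5 => -5 / 4
  | 4, 6 => -5 / 4
  | 4, 7 => -1
  | 5, 6 => 2
  | _, _ => 0

/-- The products of `R(g³_{(n,1)}, 1)` in the basis `e_1, …, e_n, x = v_0`. -/
theorem rg3_lie_e {n : ℕ} (hn : 7 ≤ n) {i j : ℕ} (hi : 1 ≤ i) (hij : i < j) (hj : j ≤ n) :
    ⁅rg3E n i, rg3E n j⁆ =
      if i = 1 ∧ 2 ≤ j ∧ j ≤ n - 2 then rg3E n (j + 1)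
      else if 2 ≤ i ∧ i ≤ n - 3 ∧ j = n then rg3E n (i + 2)
      else if i = 2 ∧ 3 ≤ j ∧ j ≤ n - 4 then rg3E n (j + 3)
      else 0 := by
  have hz : ∀ k, n < k → (Rg3 n).v k = 0 := fun k hk => stdVec_of_lt hk
  have he : ∀ k, 2 ≤ k → k < n → rg3E n k = (Rg3 n).v (k + 1) := fun k h2 hk => by
    rw [rg3E, rg3Weight, if_neg (by omega), if_neg (by omega)]
  have he1 : rg3E n 1 = (Rg3 n).v 1 := by rw [rg3E, rg3Weight, if_pos rfl]
  have hen : rg3E n n = (Rg3 n).v 2 := by rw [rg3E, rg3Weight, if_neg (by omega), if_pos rfl]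
  rcases Nat.lt_or_ge 1 i with h1 | h1
  · rw [if_neg (by omega)]
    rcases Nat.lt_or_ge j n with h2 | h2
    · rw [if_neg (by omega), he i (by omega) (by omega), he j (by omega) (by omega),
        GradedTable.lie_v]
      by_cases h3 : i = 2
      · subst h3
        have hc : (Rg3 n).coeff (2 + 1) (j + 1) = 1 := by
          simp [GradedTable.coeff, Rg3]; grind
        rw [hc, one_smul]
        by_cases h4 : j ≤ n - 4
        · rw [if_pos (by omega), he (j + 3) (by omega) (by omega)]
          congr 1; omega
        · rw [if_neg (by omega), hz _ (by omega)]
      · have hc : (Rg3 n).coeff (i + 1) (j + 1) = 0 := by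
          simp [GradedTable.coeff, Rg3]; grind
        rw [hc, zero_smul, if_neg (by omega)]
    · obtain rfl : j = n := by omega
      have hc : (Rg3 j).coeff (i + 1) 2 = 1 := by
        simp [GradedTable.coeff, Rg3]; grind
      rw [hen, he i (by omega) (by omega), GradedTable.lie_v, hc, one_smul]
      by_cases h4 : i ≤ j - 3
      · rw [if_pos (by omega), he (i + 2) (by omega) (by omega)]
      · rw [if_neg (by omega), if_neg (by omega), hz _ (by omega)]
  · obtain rfl : i = 1 := by omega
    rcases Nat.lt_or_ge j n with h2 | h2
    · have hc : (Rg3 n).coeff 1 (j + 1) = 1 := by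
        simp [GradedTable.coeff, Rg3]; grind
      rw [he1, he j (by omega) (by omega), GradedTable.lie_v, hc, one_smul]
      by_cases h4 : j ≤ n - 2
      · rw [if_pos (by omega), he (j + 1) (by omega) (by omega)]
        congr 1; omega
      · rw [if_neg (by omega), if_neg (by omega), if_neg (by omega), hz _ (by omega)]
    · obtain rfl : j = n := by omega
      rw [he1, hen, GradedTable.lie_v, if_neg (by omega), if_neg (by omega), if_neg (by omega)]
      have hc : (Rg3 j).coeff 1 2 = 0 := by simp [GradedTable.coeff, Rg3]
      rw [hc, zero_smul]

/-- The action of `x = v_0` on `R(g³_{(n,1)}, 1)`. -/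
theorem rg3_lie_x (n i : ℕ) :
    ⁅rg3E n i, (Rg3 n).v 0⁆ =
      (if i = 1 then 1 else if i = n then 2 else (i + 1 : ℂ)) • rg3E n i := by
  rw [rg3E, GradedTable.lie_v, add_zero]
  congr 1
  have hc : ∀ w, (Rg3 n).coeff w 0 = w := by
    intro w
    rcases w with _ | w <;> simp [GradedTable.coeff, Rg3]
  rw [hc, rg3Weight]
  split_ifs <;> push_cast <;> rfl

/-- The values of the cochain of `rg3Values` on the `e_i`. -/
theorem rg3Cochain_e {n : ℕ} (hn : 7 ≤ n) {i j : ℕ} (hi : 1 ≤ i) (hij : i < j) (hj : j ≤ n) :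
    (Rg3 n).cochain rg3Values (rg3E n i) (rg3E n j) =
      if i = 1 ∧ j = n then rg3E n 2
      else if 4 ≤ i ∧ i ≤ n - 3 ∧ j = n then (i - 3 : ℂ) • rg3E n (i + 2)
      else if i = 2 ∧ 5 ≤ j ∧ j ≤ n - 4 then (3 / 2 * (j - 4) : ℂ) • rg3E n (j + 3)
      else if i = 3 ∧ 4 ≤ j ∧ j ≤ n - 5 then (-3 / 2 : ℂ) • rg3E n (j + 4)
      else 0 := by
  have hz : ∀ k, n < k → (Rg3 n).v k = 0 := fun k hk => stdVec_of_lt hk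
  have he : ∀ k, 2 ≤ k → k < n → rg3E n k = (Rg3 n).v (k + 1) := fun k h2 hk => by
    rw [rg3E, rg3Weight, if_neg (by omega), if_neg (by omega)]
  have he1 : rg3E n 1 = (Rg3 n).v 1 := by rw [rg3E, rg3Weight, if_pos rfl]
  have hen : rg3E n n = (Rg3 n).v 2 := by rw [rg3E, rg3Weight, if_neg (by omega), if_pos rfl]
  rcases Nat.lt_or_ge 1 i with h1 | h1
  · rw [if_neg (by omega)]
    rcases Nat.lt_or_ge j n with h2 | h2
    · rw [if_neg (by omega), he i (by omega) (by omega), he j (by omega) (by omega),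
        GradedTable.cochain_v]
      by_cases h3 : i = 2
      · subst h3
        rw [if_neg (by omega : ¬(2 = 3 ∧ _))]
        by_cases h5 : 5 ≤ j
        · have hc : rg3Values (2 + 1) (j + 1) - rg3Values (j + 1) (2 + 1) = 3 / 2 * (j - 4) := by
            simp [rg3Values]; grind
          rw [hc]
          by_cases h4 : j ≤ n - 4
          · rw [if_pos (by omega), he (j + 3) (by omega) (by omega)]
            push_cast
            congr 2; omega
          · rw [if_neg (by omega), hz _ (by omega), smul_zero]
        · have hc : rg3Values (2 + 1) (j + 1) - rg3Values (j + 1) (2 + 1) = 0 := by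
            simp [rg3Values]; grind
          rw [hc, if_neg (by omega), Rat.cast_zero, zero_smul]
      · rw [if_neg (by omega)]
        by_cases h5 : i = 3
        · subst h5
          have hc : rg3Values (3 + 1) (j + 1) - rg3Values (j + 1) (3 + 1) = -3 / 2 := by
            simp [rg3Values]; grind
          rw [hc]
          by_cases h4 : j ≤ n - 5
          · rw [if_pos (by omega), he (j + 4) (by omega) (by omega)]
            push_cast
            congr 2; omega
          · rw [if_neg (by omega), hz _ (by omega), smul_zero]
        · have hc : rg3Values (i + 1) (j + 1) - rg3Values (j + 1) (i + 1) = 0 := by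
            simp [rg3Values]; grind
          rw [hc, if_neg (by omega), Rat.cast_zero, zero_smul]
    · obtain rfl : j = n := by omega
      rw [if_neg (by omega : ¬(i = 2 ∧ _)), if_neg (by omega : ¬(i = 3 ∧ _)),
        hen, he i (by omega) (by omega), GradedTable.cochain_v]
      by_cases h5 : 4 ≤ i
      · have hc : rg3Values (i + 1) 2 - rg3Values 2 (i + 1) = i - 3 := by
          simp [rg3Values]; grind
        rw [hc]
        by_cases h4 : i ≤ j - 3
        · rw [if_pos (by omega), he (i + 2) (by omega) (by omega)]
          push_cast
          rfl
        · rw [if_neg (by omega), hz _ (by omega), smul_zero]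
      · have hc : rg3Values (i + 1) 2 - rg3Values 2 (i + 1) = 0 := by
          simp [rg3Values]; grind
        rw [hc, if_neg (by omega), Rat.cast_zero, zero_smul]
  · obtain rfl : i = 1 := by omega
    rcases Nat.lt_or_ge j n with h2 | h2
    · have hc : rg3Values 1 (j + 1) - rg3Values (j + 1) 1 = 0 := by
        simp [rg3Values]; grind
      rw [he1, he j (by omega) (by omega), GradedTable.cochain_v, hc, if_neg (by omega),
        if_neg (by omega), if_neg (by omega), if_neg (by omega), Rat.cast_zero, zero_smul]
    · obtain rfl : j = n := by omega
      rw [if_pos (by omega), he1, hen, he 2 (by omega) (by omega), GradedTable.cochain_v]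
      simp [rg3Values]

end

/-!
In the basis `v_0, …, v_n` the element `v_0` acts semisimply, with `v_i` of weight `i`. By Cartan's
formula the Lie derivative along `v_0` is homotopic to zero, so every `2`-cocycle is cohomologous to
its part of weight `0`, which has the form `(v_i, v_j) ↦ C i j • v_{i+j}` with scalars `C i j`. The
coboundary of a suitable diagonal map `v_i ↦ a_i • v_i` can then be subtracted to make row `1` of
`C` vanish, up to one entry `C i₀ j₀` for which `[v_{i₀}, v_{j₀}] = 0`: no coboundary changes it,
and it accounts for the dimension `1`. When this entry is zero as well, the cocycle identity for
`v_1, v_i, v_j` becomes Pascal's rule `C i j = C (i + 1) j + C i (j + 1)` away from the border of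
the table, which determines `C` by its entries next to the diagonal; these vanish by the rest of
the normalisation and the identities for `v_2, v_i, v_j`.
-/

noncomputable section

section Cohomology

variable {K L M : Type*} [CommRing K] [LieRing L] [LieAlgebra K L]
  [AddCommGroup M] [Module K M]

@[simp]
theorem twoCochain_sub_apply (φ ψ : twoCochain K L M) (x y : L) :
    (φ - ψ) x y = φ x y - ψ x y := rfl

variable [LieRingModule L M] [LieModule K L M]

theorem range_d₁₂_le_twoCocycle : LinearMap.range (d₁₂ K L M) ≤ twoCocycle K L M := by
  rintro _ ⟨f, rfl⟩
  exact (mem_twoCocycle_iff K L M _).2 (LinearMap.congr_fun (d₂₃_comp_d₁₂ K L M) f)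

/-- Cartan's formula on cocycles: contracting with `x` and applying `d` gives the Lie derivative
along `x`. -/
theorem d₁₂_contraction_apply {φ : twoCochain K L M} (hφ : φ ∈ twoCocycle K L M) (x y z : L) :
    d₁₂ K L M (φ x) y z = ⁅x, φ y z⁆ - φ ⁅x, y⁆ z - φ y ⁅x, z⁆ := by
  have h := LinearMap.congr_fun (LinearMap.congr_fun
    (LinearMap.congr_fun ((mem_twoCocycle_iff K L M φ).1 hφ) x) y) z
  simp only [d₂₃_apply, LinearMap.zero_apply] at h
  rw [d₁₂_apply_apply, ← sub_eq_zero, ← neg_eq_zero, ← h, ← twoCochain_skew φ y ⁅x, z⁆,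
    ← twoCochain_skew φ x ⁅y, z⁆]
  abel

theorem mem_range_lieD12_iff (φ : LieZ2 K L M) :
    φ ∈ LinearMap.range (lieD12 K L M) ↔
      ((show twoCocycle K L M from φ) : twoCochain K L M) ∈ LinearMap.range (d₁₂ K L M) := by
  constructor
  · rintro ⟨f, rfl⟩
    exact ⟨f, rfl⟩
  · rintro ⟨f, hf⟩
    exact ⟨f, Subtype.ext hf⟩

end Cohomology

theorem finrank_lieH2_eq_one {K L M : Type*} [Field K] [LieRing L] [LieAlgebra K L]
    [AddCommGroup M] [Module K M] [LieRingModule L M] [LieModule K L M] {p : twoCochain K L M}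
    (hp : p ∈ twoCocycle K L M) (hp' : p ∉ LinearMap.range (d₁₂ K L M))
    (h : ∀ φ ∈ twoCocycle K L M, ∃ t : K, φ - t • p ∈ LinearMap.range (d₁₂ K L M)) :
    Module.finrank K (LieH2 K L M) = 1 := by
  let P : LieZ2 K L M := (⟨p, hp⟩ : twoCocycle K L M)
  refine finrank_eq_one ((LinearMap.range (lieD12 K L M)).mkQ P) ?_ fun w => ?_
  · rw [Submodule.mkQ_apply, Ne, Submodule.Quotient.mk_eq_zero, mem_range_lieD12_iff]
    exact hp'
  · obtain ⟨φ, rfl⟩ := Submodule.mkQ_surjective _ w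
    obtain ⟨t, ht⟩ := h _ (show twoCocycle K L M from φ).2
    refine ⟨t, ?_⟩
    rw [← map_smul, eq_comm, ← sub_eq_zero, ← map_sub, Submodule.mkQ_apply,
      Submodule.Quotient.mk_eq_zero, mem_range_lieD12_iff]
    exact ht

section Transport

variable {K L L' M M' : Type*} [CommRing K] [LieRing L] [LieAlgebra K L]
  [LieRing L'] [LieAlgebra K L'] [AddCommGroup M] [Module K M] [AddCommGroup M'] [Module K M']

/-- Transport of `2`-cochains along linear isomorphisms of the Lie algebra and of the
coefficients. -/
def twoCochainCongr (e : L ≃ₗ[K] L') (g : M ≃ₗ[K] M') : twoCochain K L M ≃ₗ[K] twoCochain K L' M' :=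
  (e.arrowCongr (e.arrowCongr g)).ofSubmodules _ _ <| by
    ext φ
    rw [Submodule.map_equiv_eq_comap_symm, Submodule.mem_comap]
    refine ⟨fun h x => ?_, fun h x => ?_⟩
    · simpa using h (e.symm x)
    · simpa using h (e x)

@[simp]
theorem twoCochainCongr_apply (e : L ≃ₗ[K] L') (g : M ≃ₗ[K] M') (φ : twoCochain K L M) (x y : L') :
    twoCochainCongr e g φ x y = g (φ (e.symm x) (e.symm y)) := rfl

variable [LieRingModule L M] [LieModule K L M] [LieRingModule L' M'] [LieModule K L' M']

theorem d₁₂_arrowCongr (e : L ≃ₗ⁅K⁆ L') (g : M ≃ₗ[K] M') (hg : ∀ x m, g ⁅x, m⁆ = ⁅e x, g m⁆)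
    (f : oneCochain K L M) :
    d₁₂ K L' M' (e.toLinearEquiv.arrowCongr g f) =
      twoCochainCongr e.toLinearEquiv g (d₁₂ K L M f) := by
  have hsymm (x : L) : e.toLinearEquiv.symm (e x) = x := e.symm_apply_apply x
  refine Subtype.ext (LinearMap.ext₂ fun x y => ?_)
  obtain ⟨⟨x, rfl⟩, y, rfl⟩ := And.intro (e.surjective x) (e.surjective y)
  simp [hg, hsymm, ← LieEquiv.map_lie]

theorem d₂₃_twoCochainCongr (e : L ≃ₗ⁅K⁆ L') (g : M ≃ₗ[K] M')
    (hg : ∀ x m, g ⁅x, m⁆ = ⁅e x, g m⁆) (φ : twoCochain K L M) :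
    d₂₃ K L' M' (twoCochainCongr e.toLinearEquiv g φ) =
      e.toLinearEquiv.arrowCongr (e.toLinearEquiv.arrowCongr (e.toLinearEquiv.arrowCongr g))
        (d₂₃ K L M φ) := by
  have hsymm (x : L) : e.toLinearEquiv.symm (e x) = x := e.symm_apply_apply x
  refine LinearMap.ext₂ fun x y => LinearMap.ext fun z => ?_
  obtain ⟨⟨x, rfl⟩, ⟨y, rfl⟩, z, rfl⟩ :=
    And.intro (e.surjective x) (And.intro (e.surjective y) (e.surjective z))
  simp [hg, hsymm, ← LieEquiv.map_lie]

/-- Transport of the second cohomology along an isomorphism of Lie algebras and a compatible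
isomorphism of the coefficient modules. -/
def lieH2Congr (e : L ≃ₗ⁅K⁆ L') (g : M ≃ₗ[K] M') (hg : ∀ x m, g ⁅x, m⁆ = ⁅e x, g m⁆) :
    LieH2 K L M ≃ₗ[K] LieH2 K L' M' :=
  let E : LieZ2 K L M ≃ₗ[K] LieZ2 K L' M' :=
    (twoCochainCongr e.toLinearEquiv g).ofSubmodules (twoCocycle K L M) (twoCocycle K L' M') <| by
      ext φ
      obtain ⟨φ, rfl⟩ := (twoCochainCongr e.toLinearEquiv g).surjective φ
      rw [Submodule.map_equiv_eq_comap_symm, Submodule.mem_comap, mem_twoCocycle_iff,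
        mem_twoCocycle_iff, d₂₃_twoCochainCongr e g hg, LinearEquiv.map_eq_zero_iff]
      exact Iff.of_eq (congrArg (d₂₃ K L M · = 0) (LinearEquiv.symm_apply_apply _ φ))
  have hE : E.toLinearMap ∘ₗ lieD12 K L M =
      lieD12 K L' M' ∘ₗ (e.toLinearEquiv.arrowCongr g).toLinearMap :=
    LinearMap.ext fun f => Subtype.ext (d₁₂_arrowCongr e g hg f).symm
  Submodule.Quotient.equiv _ _ E <| by
    rw [← LinearMap.range_comp, hE, LinearEquiv.range_comp]

theorem finrank_lieH2_congr (e : L ≃ₗ⁅K⁆ L') :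
    Module.finrank K (LieH2 K L L) = Module.finrank K (LieH2 K L' L') :=
  (lieH2Congr e e.toLinearEquiv e.map_lie).finrank_eq

end Transport

section CoboundaryCoeff

variable {R S : Type*} [CommRing R] [CommRing S] {c C : ℕ → ℕ → R}

/-- The coefficient of `v_{i+j+k}` in `dφ(v_i, v_j, v_k)`, for the bracket
`[v_i, v_j] = c i j • v_{i+j}` and the alternating map `φ(v_i, v_j) = C i j • v_{i+j}`. -/
def coboundaryCoeff (c C : ℕ → ℕ → R) (i j k : ℕ) : R :=
  c i (j + k) * C j k + c j (k + i) * C k i + c k (i + j) * C i j +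
    (C i (j + k) * c j k + C j (k + i) * c k i + C k (i + j) * c i j)

theorem map_coboundaryCoeff (f : R →+* S) (c C : ℕ → ℕ → R) (i j k : ℕ) :
    f (coboundaryCoeff c C i j k) =
      coboundaryCoeff (fun a b => f (c a b)) (fun a b => f (C a b)) i j k := by
  simp only [coboundaryCoeff, map_add, map_mul]

theorem coboundaryCoeff_rotate (c C : ℕ → ℕ → R) (i j k : ℕ) :
    coboundaryCoeff c C j k i = coboundaryCoeff c C i j k := by
  simp only [coboundaryCoeff]
  ring

theorem coboundaryCoeff_swap (hc : ∀ i j, c i j = -c j i) (hC : ∀ i j, C i j = -C j i)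
    (i j k : ℕ) : coboundaryCoeff c C j i k = -coboundaryCoeff c C i j k := by
  simp only [coboundaryCoeff]
  rw [hc j i, hc i k, hc k j, hC j i, hC i k, hC k j, add_comm i k, add_comm k j, add_comm j i]
  ring

theorem coboundaryCoeff_eq_zero_of_lt [IsAddTorsionFree R] (hc : ∀ i j, c i j = -c j i)
    (hC : ∀ i j, C i j = -C j i) {N : ℕ}
    (h : ∀ i j k, i < j → j < k → i + j + k ≤ N → coboundaryCoeff c C i j k = 0)
    (i j k : ℕ) (hN : i + j + k ≤ N) : coboundaryCoeff c C i j k = 0 := by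
  have rotate := coboundaryCoeff_rotate c C
  have swap := coboundaryCoeff_swap hc hC
  have of_eq (i k : ℕ) : coboundaryCoeff c C i i k = 0 := self_eq_neg.1 (swap i i k)
  have of_le_of_le (i j k : ℕ) (hij : i ≤ j) (hjk : j ≤ k) (hN : i + j + k ≤ N) :
      coboundaryCoeff c C i j k = 0 := by
    rcases hij.eq_or_lt with rfl | hij
    · exact of_eq i k
    rcases hjk.eq_or_lt with rfl | hjk
    · rw [← rotate, of_eq j i]
    · exact h i j k hij hjk hN
  have of_min (i j k : ℕ) (hij : i ≤ j) (hik : i ≤ k) (hN : i + j + k ≤ N) :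
      coboundaryCoeff c C i j k = 0 := by
    rcases le_total j k with hjk | hkj
    · exact of_le_of_le i j k hij hjk hN
    · rw [← rotate, swap, rotate, of_le_of_le i k j hik hkj (by omega), neg_zero]
  rcases le_total i j with hij | hji
  · rcases le_total i k with hik | hki
    · exact of_min i j k hij hik hN
    · rw [← rotate, ← rotate, of_min k i j hki (by omega) (by omega)]
  · rcases le_total j k with hjk | hkj
    · rw [← rotate, of_min j k i hjk hji (by omega)]
    · rw [← rotate, ← rotate, of_min k i j (by omega) hkj (by omega)]

/-- If row `m` of `C` vanishes at `i`, `j` and `i + j`, the cocycle identity for `m, i, j` is a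
recursion for the other rows. -/
theorem coboundaryCoeff_of_row_eq_zero (hc : ∀ i j, c i j = -c j i) (hC : ∀ i j, C i j = -C j i)
    {m i j : ℕ} (hi : C m i = 0) (hj : C m j = 0) (hij : C m (i + j) = 0) :
    coboundaryCoeff c C m i j =
      c m (i + j) * C i j - c m i * C (m + i) j - c m j * C i (m + j) := by
  rw [coboundaryCoeff, hC j m, hi, hj, hij, hc j m, hC j, add_comm j m]
  ring

end CoboundaryCoeff

namespace GradedTable

variable (T : GradedTable)

section Basis

/-- The standard basis `v_0, …, v_n`. -/
def basis : Module.Basis (Fin (T.n + 1)) ℂ T.Alg := Pi.basisFun ℂ (Fin (T.n + 1))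

theorem basis_apply (i : Fin (T.n + 1)) : T.basis i = T.v i := (stdVec_fin i).symm

theorem v_of_lt {k : ℕ} (hk : T.n < k) : T.v k = 0 := stdVec_of_lt hk

variable {V : Type*} [AddCommGroup V] [Module ℂ V]

variable {T} in
theorem linearMap_ext_v {f g : T.Alg →ₗ[ℂ] V} (h : ∀ i ≤ T.n, f (T.v i) = g (T.v i)) : f = g :=
  T.basis.ext fun i => by simpa only [basis_apply] using h i (by omega)

variable {T} in
theorem twoCochain_ext_v {φ ψ : twoCochain ℂ T.Alg T.Alg}
    (h : ∀ i ≤ T.n, ∀ j ≤ T.n, φ (T.v i) (T.v j) = ψ (T.v i) (T.v j)) : φ = ψ :=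
  Subtype.ext (linearMap_ext_v fun i hi => linearMap_ext_v (h i hi))

theorem basis_constr_v (F : ℕ → V) {i : ℕ} (hi : i ≤ T.n) :
    T.basis.constr ℂ (fun k => F k) (T.v i) = F i := by
  have h := T.basis.constr_basis ℂ (fun k => F k) ⟨i, by omega⟩
  rwa [basis_apply] at h

/-- The coordinate of index `k` (zero for `k > n`). -/
def coord (k : ℕ) : T.Alg →ₗ[ℂ] ℂ := T.basis.constr ℂ fun j => if (j : ℕ) = k then 1 else 0

theorem coord_v (j : ℕ) {k : ℕ} (hk : k ≤ T.n) : T.coord k (T.v j) = if j = k then 1 else 0 := by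
  rcases le_or_gt j T.n with hj | hj
  · exact T.basis_constr_v (fun j => if j = k then 1 else 0) hj
  · rw [T.v_of_lt hj, map_zero, if_neg (by omega)]

theorem coord_smul_v (j k : ℕ) : T.coord k (T.v j) • T.v k = if j = k then T.v k else 0 := by
  rcases le_or_gt k T.n with hk | hk
  · rw [T.coord_v j hk, ite_smul, one_smul, zero_smul]
  · rw [T.v_of_lt hk, smul_zero, ite_self]

theorem coord_lie_v {i j : ℕ} (hij : i + j ≤ T.n) (u : T.Alg) :
    T.coord (i + j) ⁅T.v i, u⁆ = T.coeff i j * T.coord j u := by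
  have h : T.coord (i + j) ∘ₗ T.bilin T.coeff (T.v i) = T.coeff i j • T.coord j := by
    refine linearMap_ext_v fun k _ => ?_
    simp only [LinearMap.comp_apply, LinearMap.smul_apply, bilin_v, map_smul,
      T.coord_v _ hij, T.coord_v _ (show j ≤ T.n by omega), add_right_inj, smul_eq_mul]
    split_ifs with h
    · rw [h]
    · rw [mul_zero, mul_zero]
  exact LinearMap.congr_fun h u

/-- The linear map `v_i ↦ a_i • v_i`. -/
def diag (a : ℕ → ℂ) : T.Alg →ₗ[ℂ] T.Alg := T.basis.constr ℂ fun i => a i • T.v i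

theorem diag_v (a : ℕ → ℂ) (i : ℕ) : T.diag a (T.v i) = a i • T.v i := by
  rcases le_or_gt i T.n with hi | hi
  · exact T.basis_constr_v (fun i => a i • T.v i) hi
  · rw [T.v_of_lt hi, map_zero, smul_zero]

end Basis

section HomogeneousCochains

/-- The alternating map `(v_i, v_j) ↦ C i j • v_{i+j}`; these are the cochains of weight `0`. -/
def homCochain (C : ℕ → ℕ → ℂ) (hC : ∀ i j, C i j = -C j i) : twoCochain ℂ T.Alg T.Alg :=
  ⟨T.bilin C, gradedBilin_self T.n C hC⟩

variable {T} {C D : ℕ → ℕ → ℂ}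

theorem homCochain_v (hC : ∀ i j, C i j = -C j i) (i j : ℕ) :
    T.homCochain C hC (T.v i) (T.v j) = C i j • T.v (i + j) := T.bilin_v C i j

theorem d₂₃_homCochain_v (hC : ∀ i j, C i j = -C j i) (i j k : ℕ) :
    d₂₃ ℂ T.Alg T.Alg (T.homCochain C hC) (T.v i) (T.v j) (T.v k) =
      coboundaryCoeff T.coeff C i j k • T.v (i + j + k) := by
  simp only [d₂₃_apply, lie_v, homCochain_v, lie_smul, map_smul, LinearMap.smul_apply, smul_smul]
  rw [show j + (i + k) = i + j + k by omega, show k + (i + j) = i + j + k by omega,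
    show i + (j + k) = i + j + k by omega, show i + k + j = i + j + k by omega,
    show j + k + i = i + j + k by omega]
  simp only [← sub_smul, ← add_smul]
  rw [coboundaryCoeff, hC k i, T.coeff_skew k i, hC i (j + k), hC j (k + i), hC k (i + j),
    add_comm k i]
  congr 1
  ring

variable (T) in
/-- The coefficients of the cocycles of weight `0`. Only the coefficients with `i + j ≤ n` carry
information, as `v_k = 0` for `k > n`. -/
structure IsCocycle (C : ℕ → ℕ → ℂ) : Prop where
  skew : ∀ i j, C i j = -C j i
  coboundaryCoeff_eq_zero : ∀ i j k, i + j + k ≤ T.n → coboundaryCoeff T.coeff C i j k = 0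

theorem homCochain_mem_twoCocycle_iff (hC : ∀ i j, C i j = -C j i) :
    T.homCochain C hC ∈ twoCocycle ℂ T.Alg T.Alg ↔ T.IsCocycle C := by
  rw [mem_twoCocycle_iff]
  refine ⟨fun h => ⟨hC, fun i j k hijk => ?_⟩, fun h => ?_⟩
  · have h0 := congrArg (T.coord (i + j + k)) (d₂₃_homCochain_v (T := T) hC i j k)
    rw [h, map_smul, T.coord_v _ hijk, if_pos rfl, smul_eq_mul, mul_one] at h0
    rw [← h0, LinearMap.zero_apply, LinearMap.zero_apply, LinearMap.zero_apply, map_zero]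
  · refine linearMap_ext_v fun i _ => linearMap_ext_v fun j _ => linearMap_ext_v fun k _ => ?_
    rw [d₂₃_homCochain_v]
    rcases le_or_gt (i + j + k) T.n with hijk | hijk
    · rw [h.coboundaryCoeff_eq_zero i j k hijk, zero_smul]
      rfl
    · rw [T.v_of_lt hijk, smul_zero]
      rfl

theorem IsCocycle.sub (hC : T.IsCocycle C) (hD : T.IsCocycle D) :
    T.IsCocycle fun i j => C i j - D i j where
  skew i j := by rw [hC.skew, hD.skew, neg_sub_neg, neg_sub]
  coboundaryCoeff_eq_zero i j k h := by
    have hC' := hC.coboundaryCoeff_eq_zero i j k h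
    have hD' := hD.coboundaryCoeff_eq_zero i j k h
    rw [coboundaryCoeff] at hC' hD' ⊢
    linear_combination hC' - hD'

theorem IsCocycle.const_mul (hC : T.IsCocycle C) (t : ℂ) :
    T.IsCocycle fun i j => t * C i j where
  skew i j := by rw [hC.skew, mul_neg]
  coboundaryCoeff_eq_zero i j k h := by
    have hC' := hC.coboundaryCoeff_eq_zero i j k h
    rw [coboundaryCoeff] at hC' ⊢
    linear_combination t * hC'

theorem IsCocycle.self_eq_zero (hC : T.IsCocycle C) (i : ℕ) : C i i = 0 :=
  self_eq_neg.1 (hC.skew i i)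

theorem IsCocycle.eq_zero_of_forall_lt (hC : T.IsCocycle C)
    (h : ∀ i j, i < j → i + j ≤ T.n → C i j = 0) {i j : ℕ} (hij : i + j ≤ T.n) : C i j = 0 := by
  rcases lt_trichotomy i j with hlt | rfl | hgt
  · exact h i j hlt hij
  · exact hC.self_eq_zero i
  · rw [hC.skew, h j i hgt (by omega), neg_zero]

theorem IsCocycle.recursion_of_row_eq_zero (hC : T.IsCocycle C) {m i j : ℕ}
    (hn : m + i + j ≤ T.n) (hi : C m i = 0) (hj : C m j = 0) (hij : C m (i + j) = 0) :
    T.coeff m (i + j) * C i j = T.coeff m i * C (m + i) j + T.coeff m j * C i (m + j) := by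
  have h := coboundaryCoeff_of_row_eq_zero T.coeff_skew hC.skew hi hj hij
  rw [hC.coboundaryCoeff_eq_zero m i j hn] at h
  linear_combination -h

variable (T) in
/-- The coefficients of the coboundary of the diagonal map `v_i ↦ a_i • v_i`. -/
def diagCoboundary (a : ℕ → ℂ) (i j : ℕ) : ℂ := T.coeff i j * (a i + a j - a (i + j))

theorem diagCoboundary_skew (a : ℕ → ℂ) (i j : ℕ) :
    T.diagCoboundary a i j = -T.diagCoboundary a j i := by
  rw [diagCoboundary, diagCoboundary, T.coeff_skew, add_comm i j]
  ring

theorem d₁₂_diag (a : ℕ → ℂ) : d₁₂ ℂ T.Alg T.Alg (T.diag a) =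
    T.homCochain (T.diagCoboundary a) (diagCoboundary_skew a) := by
  refine twoCochain_ext_v fun i _ j _ => ?_
  rw [homCochain_v, d₁₂_apply_apply]
  simp only [diag_v, lie_smul, lie_v, map_smul, smul_smul]
  rw [add_comm j i, ← sub_smul, ← sub_smul, diagCoboundary, T.coeff_skew j i]
  congr 1
  ring

theorem isCocycle_diagCoboundary (a : ℕ → ℂ) : T.IsCocycle (T.diagCoboundary a) := by
  rw [← homCochain_mem_twoCocycle_iff (diagCoboundary_skew a), ← d₁₂_diag]
  exact range_d₁₂_le_twoCocycle ⟨_, rfl⟩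

theorem homCochain_mem_range_d₁₂ (hC : ∀ i j, C i j = -C j i) {a : ℕ → ℂ}
    (h : ∀ i j, i + j ≤ T.n → C i j = T.diagCoboundary a i j) :
    T.homCochain C hC ∈ LinearMap.range (d₁₂ ℂ T.Alg T.Alg) := by
  refine ⟨T.diag a, ?_⟩
  rw [d₁₂_diag]
  refine twoCochain_ext_v fun i _ j _ => ?_
  rw [homCochain_v, homCochain_v]
  rcases le_or_gt (i + j) T.n with hij | hij
  · rw [h i j hij]
  · rw [T.v_of_lt hij, smul_zero, smul_zero]

/-- Only diagonal `1`-cochains could contribute to the coefficient of `v_{i+j}`, and they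
contribute multiples of the structure constant. -/
theorem homCochain_notMem_range_d₁₂ (hC : ∀ i j, C i j = -C j i) {i j : ℕ} (hij : i + j ≤ T.n)
    (hc : T.coeff i j = 0) (hCij : C i j ≠ 0) :
    T.homCochain C hC ∉ LinearMap.range (d₁₂ ℂ T.Alg T.Alg) := by
  rintro ⟨f, hf⟩
  have h : d₁₂ ℂ T.Alg T.Alg f (T.v i) (T.v j) = C i j • T.v (i + j) := by rw [hf, homCochain_v]
  have hcoord : T.coord (i + j) ⁅T.v j, f (T.v i)⁆ = T.coeff j i * T.coord i (f (T.v i)) := by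
    rw [add_comm i j, T.coord_lie_v (by omega)]
  rw [d₁₂_apply_apply, lie_v, hc, zero_smul, map_zero, sub_zero] at h
  replace h := congrArg (T.coord (i + j)) h
  rw [map_sub, T.coord_lie_v hij, hcoord, map_smul, T.coord_v _ hij, if_pos rfl, T.coeff_skew j i,
    hc, neg_zero, zero_mul, zero_mul, sub_zero, smul_eq_mul, mul_one] at h
  exact hCij h.symm

end HomogeneousCochains

variable {T}

section Weights

variable (T) in
/-- The element `v_0` acts on the basis by the grading: `[v_i, v_0] = i • v_i`. -/
def HasGradingElement : Prop := ∀ i, T.coeff i 0 = i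

variable (T) in
/-- The operator dividing the component of weight `k` by `w - k`; since `0⁻¹ = 0`, it kills the
component of weight `w`. -/
def weightResolvent (w : ℂ) : T.Alg →ₗ[ℂ] T.Alg := T.diag fun k => (w - k)⁻¹

theorem weightResolvent_v (w : ℂ) (k : ℕ) :
    T.weightResolvent w (T.v k) = (w - k)⁻¹ • T.v k := T.diag_v _ _

theorem weightResolvent_lie_v (i j : ℕ) (u : T.Alg) :
    T.weightResolvent ((i + j : ℕ) : ℂ) ⁅T.v i, u⁆ = ⁅T.v i, T.weightResolvent j u⁆ := by
  have h : T.weightResolvent ((i + j : ℕ) : ℂ) ∘ₗ T.bilin T.coeff (T.v i) =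
      T.bilin T.coeff (T.v i) ∘ₗ T.weightResolvent j := by
    refine linearMap_ext_v fun k _ => ?_
    simp only [LinearMap.comp_apply, bilin_v, weightResolvent_v, map_smul, smul_smul]
    rw [mul_comm, Nat.cast_add, Nat.cast_add, add_sub_add_left_eq_sub]
  exact LinearMap.congr_fun h u

theorem HasGradingElement.lie_v_zero_v (hT : T.HasGradingElement) (i : ℕ) :
    ⁅T.v 0, T.v i⁆ = -(i : ℂ) • T.v i := by
  rw [lie_v, T.coeff_skew, hT, zero_add]

theorem HasGradingElement.weightResolvent_smul_add_lie (hT : T.HasGradingElement) (w : ℕ)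
    (u : T.Alg) :
    T.weightResolvent w ((w : ℂ) • u + ⁅T.v 0, u⁆) = u - T.coord w u • T.v w := by
  have h : T.weightResolvent w ∘ₗ ((w : ℂ) • LinearMap.id + T.bilin T.coeff (T.v 0)) =
      LinearMap.id - (T.coord w).smulRight (T.v w) := by
    refine linearMap_ext_v fun k _ => ?_
    have hlie : T.bilin T.coeff (T.v 0) (T.v k) = -(k : ℂ) • T.v k := hT.lie_v_zero_v k
    simp only [LinearMap.comp_apply, LinearMap.add_apply, LinearMap.sub_apply,
      LinearMap.smul_apply, LinearMap.id_apply, LinearMap.smulRight_apply, hlie, ← add_smul,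
      map_smul, weightResolvent_v, smul_smul, T.coord_smul_v, ← sub_eq_add_neg]
    rcases eq_or_ne k w with rfl | hkw
    · rw [sub_self, zero_mul, zero_smul, if_pos rfl, sub_self]
    · have hne : (w : ℂ) - k ≠ 0 := sub_ne_zero.2 (Nat.cast_injective.ne hkw.symm)
      rw [mul_inv_cancel₀ hne, one_smul, if_neg hkw, sub_zero]
  exact LinearMap.congr_fun h u

/-- The `1`-cochain obtained from `ψ` by dividing each component of nonzero weight by its
weight. -/
def resolve (ψ : oneCochain ℂ T.Alg T.Alg) : oneCochain ℂ T.Alg T.Alg :=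
  T.basis.constr ℂ fun i => T.weightResolvent ((i : ℕ) : ℂ) (ψ (T.v i))

theorem resolve_v (ψ : oneCochain ℂ T.Alg T.Alg) (i : ℕ) :
    resolve ψ (T.v i) = T.weightResolvent i (ψ (T.v i)) := by
  rcases le_or_gt i T.n with hi | hi
  · exact T.basis_constr_v (fun i => T.weightResolvent (i : ℂ) (ψ (T.v i))) hi
  · rw [T.v_of_lt hi, map_zero, map_zero, map_zero]

theorem d₁₂_resolve_v (ψ : oneCochain ℂ T.Alg T.Alg) (i j : ℕ) :
    d₁₂ ℂ T.Alg T.Alg (resolve ψ) (T.v i) (T.v j) =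
      T.weightResolvent ((i + j : ℕ) : ℂ) (d₁₂ ℂ T.Alg T.Alg ψ (T.v i) (T.v j)) := by
  rw [d₁₂_apply_apply, d₁₂_apply_apply, map_sub, map_sub, weightResolvent_lie_v, resolve_v,
    resolve_v, add_comm i j, weightResolvent_lie_v, lie_v, map_smul, map_smul, map_smul, resolve_v,
    add_comm i j]

theorem HasGradingElement.d₁₂_contraction_v (hT : T.HasGradingElement)
    {φ : twoCochain ℂ T.Alg T.Alg} (hφ : φ ∈ twoCocycle ℂ T.Alg T.Alg) (i j : ℕ) :
    d₁₂ ℂ T.Alg T.Alg (φ (T.v 0)) (T.v i) (T.v j) =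
      ((i + j : ℕ) : ℂ) • φ (T.v i) (T.v j) + ⁅T.v 0, φ (T.v i) (T.v j)⁆ := by
  rw [d₁₂_contraction_apply hφ, hT.lie_v_zero_v, hT.lie_v_zero_v, map_smul, map_smul,
    LinearMap.smul_apply, Nat.cast_add]
  module

/-- By Cartan's formula, subtracting `d (resolve (φ v_0))` from `φ` leaves its part of
weight `0`. -/
theorem HasGradingElement.exists_sub_homCochain_mem_range (hT : T.HasGradingElement)
    {φ : twoCochain ℂ T.Alg T.Alg} (hφ : φ ∈ twoCocycle ℂ T.Alg T.Alg) :
    ∃ (C : ℕ → ℕ → ℂ) (hC : T.IsCocycle C),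
      φ - T.homCochain C hC.skew ∈ LinearMap.range (d₁₂ ℂ T.Alg T.Alg) := by
  let C (i j : ℕ) : ℂ := T.coord (i + j) (φ (T.v i) (T.v j))
  have hskew (i j : ℕ) : C i j = -C j i := by
    simp only [C]
    rw [← twoCochain_skew φ (T.v j), map_neg, add_comm j i]
  have hd : φ - T.homCochain C hskew = d₁₂ ℂ T.Alg T.Alg (resolve (φ (T.v 0))) := by
    refine twoCochain_ext_v fun i _ j _ => ?_
    rw [twoCochain_sub_apply, homCochain_v, d₁₂_resolve_v, hT.d₁₂_contraction_v hφ,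
      hT.weightResolvent_smul_add_lie]
  have hadd : φ + (-1 : ℂ) • d₁₂ ℂ T.Alg T.Alg (resolve (φ (T.v 0))) = T.homCochain C hskew := by
    refine twoCochain_ext_v fun i _ j _ => ?_
    rw [← hd, add_apply_apply, smul_apply_apply, twoCochain_sub_apply, neg_one_smul,
      ← sub_eq_add_neg, sub_sub_cancel]
  have hC : T.homCochain C hskew ∈ twoCocycle ℂ T.Alg T.Alg :=
    hadd ▸ add_mem hφ (Submodule.smul_mem _ _ (range_d₁₂_le_twoCocycle ⟨_, rfl⟩))
  exact ⟨C, (homCochain_mem_twoCocycle_iff hskew).1 hC, _, hd.symm⟩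

theorem HasGradingElement.exists_sub_smul_mem_range (hT : T.HasGradingElement)
    {P : ℕ → ℕ → ℂ} (hP : T.IsCocycle P) {i₀ j₀ : ℕ} (hP₀ : P i₀ j₀ ≠ 0)
    (h : ∀ C, T.IsCocycle C → C i₀ j₀ = 0 →
      ∃ a, ∀ i j, i + j ≤ T.n → C i j = T.diagCoboundary a i j)
    {φ : twoCochain ℂ T.Alg T.Alg} (hφ : φ ∈ twoCocycle ℂ T.Alg T.Alg) :
    ∃ t : ℂ, φ - t • T.homCochain P hP.skew ∈ LinearMap.range (d₁₂ ℂ T.Alg T.Alg) := by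
  obtain ⟨C, hC, hφC⟩ := hT.exists_sub_homCochain_mem_range hφ
  let t := C i₀ j₀ / P i₀ j₀
  have hD : T.IsCocycle fun i j => C i j - t * P i j := hC.sub (hP.const_mul t)
  obtain ⟨a, ha⟩ := h _ hD (by simp only [t, div_mul_cancel₀ _ hP₀, sub_self])
  have hsum : φ - T.homCochain C hC.skew + T.homCochain _ hD.skew =
      φ - t • T.homCochain P hP.skew := by
    refine twoCochain_ext_v fun i _ j _ => ?_
    rw [add_apply_apply, twoCochain_sub_apply, twoCochain_sub_apply, smul_apply_apply,
      homCochain_v, homCochain_v, homCochain_v, smul_smul, sub_smul, sub_add_sub_cancel]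
  exact ⟨t, hsum ▸ add_mem hφC (homCochain_mem_range_d₁₂ _ ha)⟩

end Weights

section Alternation

/-- The coefficients of `T.cochain p`. -/
def alternation (p : ℕ → ℕ → ℚ) (i j : ℕ) : ℂ := ((p i j - p j i : ℚ) : ℂ)

theorem alternation_skew (p : ℕ → ℕ → ℚ) (i j : ℕ) : alternation p i j = -alternation p j i := by
  rw [alternation, alternation, ← Rat.cast_neg, neg_sub]

theorem isCocycle_alternation {p : ℕ → ℕ → ℚ}
    (h : ∀ k < T.n + 1, ∀ j < k, ∀ i < j, i + j + k ≤ T.n →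
      coboundaryCoeff (fun i j => (T.half i j - T.half j i : ℚ)) (fun i j => p i j - p j i)
        i j k = 0) :
    T.IsCocycle (alternation p) := by
  have hcoeff : T.coeff = fun i j => ((T.half i j - T.half j i : ℚ) : ℂ) := by
    funext i j
    simp only [coeff]
    norm_cast
  refine ⟨alternation_skew p, coboundaryCoeff_eq_zero_of_lt T.coeff_skew (alternation_skew p)
    fun i j k hij hjk hn => ?_⟩
  have hmap := map_coboundaryCoeff (Rat.castHom ℂ) (fun i j => (T.half i j - T.half j i : ℚ))
    (fun i j => p i j - p j i) i j k
  rw [h k (by omega) j hjk i hij hn, map_zero] at hmap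
  rw [hcoeff]
  exact hmap.symm

theorem HasGradingElement.finrank_lieH2_eq_one_and_cochain_mem_and_notMem
    (hT : T.HasGradingElement) {p : ℕ → ℕ → ℚ} (hp : T.IsCocycle (alternation p)) (i₀ j₀ : ℕ)
    (hle : i₀ + j₀ ≤ T.n) (hc : T.coeff i₀ j₀ = 0) (hp₀ : p i₀ j₀ - p j₀ i₀ ≠ 0)
    (h : ∀ C, T.IsCocycle C → C i₀ j₀ = 0 →
      ∃ a, ∀ i j, i + j ≤ T.n → C i j = T.diagCoboundary a i j) :
    (∀ (R : Type*) [LieRing R] [LieAlgebra ℂ R], Nonempty (R ≃ₗ⁅ℂ⁆ T.Alg) →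
      Module.finrank ℂ (LieH2 ℂ R R) = 1) ∧
    T.cochain p ∈ twoCocycle ℂ T.Alg T.Alg ∧
    T.cochain p ∉ LinearMap.range (d₁₂ ℂ T.Alg T.Alg) := by
  have hP₀ : alternation p i₀ j₀ ≠ 0 := Rat.cast_ne_zero.2 hp₀
  have hcocycle : T.cochain p ∈ twoCocycle ℂ T.Alg T.Alg :=
    (homCochain_mem_twoCocycle_iff hp.skew).2 hp
  have hcoboundary : T.cochain p ∉ LinearMap.range (d₁₂ ℂ T.Alg T.Alg) :=
    homCochain_notMem_range_d₁₂ hp.skew hle hc hP₀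
  refine ⟨fun R _ _ ⟨e⟩ => ?_, hcocycle, hcoboundary⟩
  rw [finrank_lieH2_congr e]
  exact finrank_lieH2_eq_one hcocycle hcoboundary fun φ hφ =>
    hT.exists_sub_smul_mem_range hp hP₀ h hφ

end Alternation

end GradedTable

theorem isCocycle_rg7Values : Rg7.IsCocycle (GradedTable.alternation rg7Values) :=
  GradedTable.isCocycle_alternation (by decide +kernel)

theorem isCocycle_rg9Values : Rg9.IsCocycle (GradedTable.alternation rg9Values) :=
  GradedTable.isCocycle_alternation (by decide +kernel)

theorem isCocycle_rg11Values : Rg11.IsCocycle (GradedTable.alternation rg11Values) :=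
  GradedTable.isCocycle_alternation (by decide +kernel)

theorem eq_zero_of_pascal {R : Type*} [AddGroup R] {C : ℕ → ℕ → R} {a N : ℕ}
    (hdiag : ∀ i, C i i = 0) (hsuper : ∀ i, a ≤ i → i + (i + 1) ≤ N → C i (i + 1) = 0)
    (hpascal : ∀ i j, a ≤ i → i < j → i + j < N → C i j = C (i + 1) j + C i (j + 1))
    {i j : ℕ} (hi : a ≤ i) (hij : i ≤ j) (h : i + j ≤ N) : C i j = 0 := by
  obtain ⟨d, rfl⟩ := Nat.exists_eq_add_of_le hij
  induction d using Nat.twoStepInduction generalizing i with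
  | zero => exact hdiag i
  | one => exact hsuper i hi h
  | more d ih₀ ih₁ =>
    have hlower : C (i + 1) (i + (d + 1)) = 0 := by
      rw [add_comm d 1, ← add_assoc]
      exact ih₀ (by omega) (by omega) (by omega)
    have hrec := hpascal i (i + (d + 1)) hi (by omega) (by omega)
    rw [hlower, zero_add, ih₁ hi (by omega) (by omega)] at hrec
    exact hrec.symm

namespace GradedTable

variable {T : GradedTable} {C : ℕ → ℕ → ℂ}

/-- For a cocycle, row `0` defines a derivation of the algebra. -/
theorem IsCocycle.row_zero_add (hC : T.IsCocycle C) (hT : T.HasGradingElement) {i j : ℕ}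
    (h : i + j ≤ T.n) (hc : T.coeff i j ≠ 0) : C 0 (i + j) = C 0 i + C 0 j := by
  have h0 := hC.coboundaryCoeff_eq_zero 0 i j (by omega)
  rw [coboundaryCoeff, T.coeff_skew 0 (i + j), hT, add_zero, hT, zero_add, T.coeff_skew 0 i, hT,
    hC.skew j 0, T.coeff_skew j i, hC.skew j i, Nat.cast_add] at h0
  refine mul_left_cancel₀ hc ?_
  linear_combination h0

section QFiliform

variable (T) in
/-- The nilradical `⟨v_1, …, v_n⟩` is a graded filiform algebra of type `Q_n`: the chain
`[v_1, v_i] = v_{i+1}` stops at `v_{n-1}`, and `v_n = [v_2, v_{n-2}]`. -/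
structure IsQFiliform : Prop where
  hasGradingElement : T.HasGradingElement
  seven_le : 7 ≤ T.n
  coeff_one : ∀ j, 2 ≤ j → j + 1 < T.n → T.coeff 1 j = 1
  coeff_one_top : T.coeff 1 (T.n - 1) = 0
  coeff_two_three : T.coeff 2 3 = 1
  coeff_two_top : T.coeff 2 (T.n - 2) = 1

variable (T) in
/-- The normal form, modulo coboundaries of diagonal maps, of the cocycles of an algebra of type
`Q_n` with `C 1 (n - 1) = 0`. -/
structure IsQNormalized (C : ℕ → ℕ → ℂ) : Prop extends T.IsCocycle C where
  zero_one : C 0 1 = 0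
  one_row : ∀ j, 2 ≤ j → 1 + j ≤ T.n → C 1 j = 0
  two_three : C 2 3 = 0
  two_top : C 2 (T.n - 2) = 0

/-- The weights `a_j` of `v_j` are determined from `a_1 = 0` along the brackets
`[v_1, v_j] = v_{j+1}`, `[v_2, v_3] = v_5` and `[v_2, v_{n-2}] = v_n`. -/
theorem IsQFiliform.exists_isQNormalized_sub_diagCoboundary (hT : T.IsQFiliform)
    (hC : T.IsCocycle C) (h : C 1 (T.n - 1) = 0) :
    ∃ a, T.IsQNormalized fun i j => C i j - T.diagCoboundary a i j := by
  have hn := hT.seven_le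
  let y := C 2 3 - C 1 3 - C 1 4
  let b (j : ℕ) : ℂ := y - ∑ t ∈ Finset.range (j - 2), C 1 (t + 2)
  let a (j : ℕ) : ℂ := if j = 0 then -C 0 1 else if j = 1 then 0
    else if j = T.n then y + b (T.n - 2) - C 2 (T.n - 2) else b j
  have a_top : a T.n = y + b (T.n - 2) - C 2 (T.n - 2) := by
    simp only [a]
    rw [if_neg (by omega), if_neg (by omega), if_pos trivial]
  have a_of_lt (j : ℕ) (h2 : 2 ≤ j) (hj : j < T.n) : a j = b j := by
    simp only [a]
    rw [if_neg (by omega), if_neg (by omega), if_neg (by omega)]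
  have b_two : b 2 = y := sub_zero y
  have b_succ (j : ℕ) (hj : 2 ≤ j) : b (j + 1) = b j - C 1 j := by
    obtain ⟨m, rfl⟩ := Nat.exists_eq_add_of_le' hj
    simp only [b, show m + 2 + 1 - 2 = m + 1 by omega, Nat.add_sub_cancel, Finset.sum_range_succ]
    ring
  refine ⟨a, hC.sub (isCocycle_diagCoboundary a), ?_, fun j h2 hj => ?_, ?_, ?_⟩
  · rw [diagCoboundary, T.coeff_skew, hT.hasGradingElement, zero_add]
    simp only [a, reduceIte, Nat.cast_one]
    ring
  · rw [diagCoboundary, add_comm 1 j]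
    rcases (show j + 1 = T.n ∨ j + 1 < T.n by omega) with hj' | hj'
    · obtain rfl : j = T.n - 1 := by omega
      rw [h, hT.coeff_one_top, zero_mul, sub_zero]
    · rw [hT.coeff_one j h2 hj', a_of_lt j h2 (by omega), a_of_lt _ (by omega) hj', b_succ j h2]
      simp only [a, one_ne_zero, reduceIte]
      ring
  · rw [diagCoboundary, hT.coeff_two_three, a_of_lt 2 le_rfl (by omega),
      a_of_lt 3 (by omega) (by omega), a_of_lt 5 (by omega) (by omega), b_succ 4 (by omega),
      b_succ 3 (by omega), b_two]
    ring
  · rw [diagCoboundary, hT.coeff_two_top, a_of_lt 2 le_rfl (by omega),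
      a_of_lt _ (by omega) (by omega), Nat.add_sub_of_le (by omega), a_top, b_two]
    ring

theorem IsQNormalized.row_zero_eq_zero (hC : T.IsQNormalized C) (hT : T.IsQFiliform) {j : ℕ}
    (hj : j ≤ T.n) : C 0 j = 0 := by
  have hn := hT.seven_le
  have add {i j : ℕ} (h : i + j ≤ T.n) (hc : T.coeff i j = 1) : C 0 (i + j) = C 0 i + C 0 j :=
    hC.row_zero_add hT.hasGradingElement h (hc ▸ one_ne_zero)
  have const (j : ℕ) (h2 : 2 ≤ j) (hj : j < T.n) : C 0 j = C 0 2 := by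
    induction j, h2 using Nat.le_induction with
    | base => rfl
    | succ j h2 ih =>
      rw [add_comm, add (by omega) (hT.coeff_one j h2 hj), hC.zero_one, zero_add, ih (by omega)]
  have two : C 0 2 = 0 := by
    have h5 := add (by omega) hT.coeff_two_three
    rwa [const _ (by omega) (by omega), const 3 (by omega) (by omega), left_eq_add] at h5
  have top := add (by omega) hT.coeff_two_top
  rw [two, const (T.n - 2) (by omega) (by omega), two, add_zero,
    Nat.add_sub_of_le (by omega)] at top
  rcases (show j = 0 ∨ j = 1 ∨ 2 ≤ j by omega) with rfl | rfl | h2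
  · exact hC.self_eq_zero 0
  · exact hC.zero_one
  rcases hj.eq_or_lt with rfl | hlt
  · exact top
  · rw [const j h2 hlt, two]

theorem IsQNormalized.pascal (hC : T.IsQNormalized C) (hT : T.IsQFiliform) {i j : ℕ}
    (hi : 2 ≤ i) (hj : 2 ≤ j) (h : i + j + 1 < T.n) : C i j = C (i + 1) j + C i (j + 1) := by
  have hrec := hC.recursion_of_row_eq_zero (by omega) (hC.one_row i hi (by omega))
    (hC.one_row j hj (by omega)) (hC.one_row (i + j) (by omega) (by omega))
  rwa [hT.coeff_one _ (by omega) h, hT.coeff_one i hi (by omega), hT.coeff_one j hj (by omega),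
    one_mul, one_mul, one_mul, add_comm 1 i, add_comm 1 j] at hrec

theorem IsQNormalized.eq_zero_of_add_eq (hC : T.IsQNormalized C) (hT : T.IsQFiliform) {i j : ℕ}
    (hi : 2 ≤ i) (hj : 2 ≤ j) (h : i + j = T.n) : C i j = 0 := by
  induction i, hi using Nat.le_induction generalizing j with
  | base =>
    obtain rfl : j = T.n - 2 := by omega
    exact hC.two_top
  | succ i hi ih =>
    have hrec := hC.recursion_of_row_eq_zero (by omega) (hC.one_row i hi (by omega))
      (hC.one_row j hj (by omega)) (hC.one_row (i + j) (by omega) (by omega))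
    rw [show i + j = T.n - 1 by omega, hT.coeff_one_top, hT.coeff_one i hi (by omega),
      hT.coeff_one j hj (by omega), add_comm 1 j, ih (j := j + 1) (by omega) (by omega),
      add_comm 1 i] at hrec
    linear_combination -hrec

theorem IsQNormalized.eq_zero (hC : T.IsQNormalized C) (hT : T.IsQFiliform)
    (hsuper : ∀ i, 3 ≤ i → i + (i + 1) < T.n → C i (i + 1) = 0) {i j : ℕ} (hij : i + j ≤ T.n) :
    C i j = 0 := by
  have hn := hT.seven_le
  refine hC.eq_zero_of_forall_lt (fun i j hlt hij => ?_) hij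
  rcases (show i = 0 ∨ i = 1 ∨ 2 ≤ i by omega) with rfl | rfl | hi
  · exact hC.row_zero_eq_zero hT (by omega)
  · exact hC.one_row j hlt hij
  rcases hij.eq_or_lt with htop | hbelow
  · exact hC.eq_zero_of_add_eq hT hi (by omega) htop
  refine eq_zero_of_pascal (N := T.n - 1) hC.self_eq_zero (fun i hi h => ?_)
    (fun i j hi hlt h => hC.pascal hT hi (by omega) (by omega)) hi hlt.le (by omega)
  rcases hi.eq_or_lt with rfl | hi
  · exact hC.two_three
  · exact hsuper i hi (by omega)

theorem IsQFiliform.exists_eq_diagCoboundary (hT : T.IsQFiliform)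
    (hsuper : ∀ D, T.IsQNormalized D → ∀ i, 3 ≤ i → i + (i + 1) < T.n → D i (i + 1) = 0)
    (hC : T.IsCocycle C) (h : C 1 (T.n - 1) = 0) :
    ∃ a, ∀ i j, i + j ≤ T.n → C i j = T.diagCoboundary a i j := by
  obtain ⟨a, hD⟩ := hT.exists_isQNormalized_sub_diagCoboundary hC h
  exact ⟨a, fun i j hij => sub_eq_zero.1 (hD.eq_zero hT (hsuper _ hD) hij)⟩

end QFiliform

end GradedTable

theorem isQFiliform_rg7 : Rg7.IsQFiliform where
  hasGradingElement i := by rcases i with _ | i <;> simp [GradedTable.coeff, Rg7]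
  seven_le := le_rfl
  coeff_one j h2 hj := by
    have hj' : j < 6 := Nat.lt_of_succ_lt_succ hj
    interval_cases j <;> simp [GradedTable.coeff, Rg7]
  coeff_one_top := by simp [GradedTable.coeff, Rg7]
  coeff_two_three := by simp [GradedTable.coeff, Rg7]
  coeff_two_top := by simp [GradedTable.coeff, Rg7]

theorem isQFiliform_rg9 : Rg9.IsQFiliform where
  hasGradingElement i := by rcases i with _ | i <;> simp [GradedTable.coeff, Rg9]
  seven_le := by decide
  coeff_one j h2 hj := by
    have hj' : j < 8 := Nat.lt_of_succ_lt_succ hj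
    interval_cases j <;> simp [GradedTable.coeff, Rg9]
  coeff_one_top := by simp [GradedTable.coeff, Rg9]
  coeff_two_three := by simp [GradedTable.coeff, Rg9]
  coeff_two_top := by simp [GradedTable.coeff, Rg9]

theorem isQFiliform_rg11 : Rg11.IsQFiliform where
  hasGradingElement i := by rcases i with _ | i <;> simp [GradedTable.coeff, Rg11]
  seven_le := by decide
  coeff_one j h2 hj := by
    have hj' : j < 10 := Nat.lt_of_succ_lt_succ hj
    interval_cases j <;> simp [GradedTable.coeff, Rg11]
  coeff_one_top := by simp [GradedTable.coeff, Rg11]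
  coeff_two_three := by simp [GradedTable.coeff, Rg11]
  coeff_two_top := by simp [GradedTable.coeff, Rg11]

theorem rg7_exists_eq_diagCoboundary {C : ℕ → ℕ → ℂ} (hC : Rg7.IsCocycle C) (h : C 1 6 = 0) :
    ∃ a, ∀ i j, i + j ≤ 7 → C i j = Rg7.diagCoboundary a i j := by
  refine isQFiliform_rg7.exists_eq_diagCoboundary (fun _ _ i hi hlt => ?_) hC h
  have hlt' : i + (i + 1) < 7 := hlt
  omega

theorem rg9_three_four_eq_zero {C : ℕ → ℕ → ℂ} (hC : Rg9.IsQNormalized C) : C 3 4 = 0 := by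
  have pascal23 := hC.pascal isQFiliform_rg9 (i := 2) (j := 3) le_rfl (by decide) (by decide)
  have h24 : C 2 4 = 0 := by
    rwa [hC.two_three, hC.self_eq_zero, zero_add, eq_comm] at pascal23
  have hrec := hC.recursion_of_row_eq_zero (m := 2) (i := 3) (j := 4) (by decide) hC.two_three
    h24 hC.two_top
  have h54 : C 5 4 = 0 := hC.eq_zero_of_add_eq isQFiliform_rg9 (by decide) (by decide) rfl
  have h36 : C 3 6 = 0 := hC.eq_zero_of_add_eq isQFiliform_rg9 (by decide) (by decide) rfl
  have c27 : Rg9.coeff 2 (3 + 4) = 1 := isQFiliform_rg9.coeff_two_top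
  rwa [c27, h54, h36, mul_zero, mul_zero, add_zero, one_mul] at hrec

theorem rg9_exists_eq_diagCoboundary {C : ℕ → ℕ → ℂ} (hC : Rg9.IsCocycle C) (h : C 1 8 = 0) :
    ∃ a, ∀ i j, i + j ≤ 9 → C i j = Rg9.diagCoboundary a i j := by
  refine isQFiliform_rg9.exists_eq_diagCoboundary (fun D hD i hi hlt => ?_) hC h
  have hlt' : i + (i + 1) < 9 := hlt
  obtain rfl : i = 3 := by omega
  exact rg9_three_four_eq_zero hD

theorem rg11_coeff_eq_of_isQNormalized {C : ℕ → ℕ → ℂ} (hC : Rg11.IsQNormalized C) :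
    C 2 6 = -2 * C 3 4 ∧ C 2 7 = -3 * C 3 4 + C 4 5 ∧ C 3 6 = C 3 4 - C 4 5 := by
  have pascal (i j : ℕ) (hi : 2 ≤ i) (hj : 2 ≤ j) (h : i + j + 1 < 11) :
      C i j = C (i + 1) j + C i (j + 1) := hC.pascal isQFiliform_rg11 hi hj h
  have h24 : C 2 4 = 0 := by
    linear_combination hC.two_three - pascal 2 3 (by decide) (by decide) (by decide) -
      hC.self_eq_zero 3
  have h25 : C 2 5 = -C 3 4 := by
    linear_combination h24 - pascal 2 4 (by decide) (by decide) (by decide)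
  have h35 : C 3 5 = C 3 4 := by
    linear_combination -hC.self_eq_zero 4 - pascal 3 4 (by decide) (by decide) (by decide)
  have h26 : C 2 6 = -2 * C 3 4 := by
    linear_combination h25 - h35 - pascal 2 5 (by decide) (by decide) (by decide)
  have h36 : C 3 6 = C 3 4 - C 4 5 := by
    linear_combination h35 - pascal 3 5 (by decide) (by decide) (by decide)
  have h27 : C 2 7 = -3 * C 3 4 + C 4 5 := by
    linear_combination h26 - h36 - pascal 2 6 (by decide) (by decide) (by decide)
  exact ⟨h26, h27, h36⟩

/-- The cocycle identities `(2, 3, 4)` and `(2, 3, 6)` give two independent linear equations in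
`C 3 4` and `C 4 5`. -/
theorem rg11_three_four_eq_zero_and_four_five_eq_zero {C : ℕ → ℕ → ℂ}
    (hC : Rg11.IsQNormalized C) : C 3 4 = 0 ∧ C 4 5 = 0 := by
  obtain ⟨h26, h27, h36⟩ := rg11_coeff_eq_of_isQNormalized hC
  have h38 : C 3 8 = 0 := hC.eq_zero_of_add_eq isQFiliform_rg11 (by decide) (by decide) rfl
  have h65 : C 6 5 = 0 := hC.eq_zero_of_add_eq isQFiliform_rg11 (by decide) (by decide) rfl
  have d234 : coboundaryCoeff Rg11.coeff C 2 3 4 =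
      -C 3 4 + C 2 3 + (C 2 7 + -C 3 6 + C 4 5) := by
    simp [coboundaryCoeff, GradedTable.coeff, Rg11]
  have d236 : coboundaryCoeff Rg11.coeff C 2 3 6 =
      C 3 6 + -C 6 2 + C 2 3 + (C 3 8 + C 6 5) := by
    simp [coboundaryCoeff, GradedTable.coeff, Rg11]
  rw [hC.coboundaryCoeff_eq_zero 2 3 4 (by decide), h27, h36, hC.two_three] at d234
  rw [hC.coboundaryCoeff_eq_zero 2 3 6 (by decide), h36, hC.skew 6 2, h26, h38, h65,
    hC.two_three] at d236
  constructor
  · linear_combination (d234 + 3 * d236) / 8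
  · linear_combination (5 * d236 - d234) / 8

theorem rg11_exists_eq_diagCoboundary {C : ℕ → ℕ → ℂ} (hC : Rg11.IsCocycle C)
    (h : C 1 10 = 0) : ∃ a, ∀ i j, i + j ≤ 11 → C i j = Rg11.diagCoboundary a i j := by
  refine isQFiliform_rg11.exists_eq_diagCoboundary (fun D hD i hi hlt => ?_) hC h
  obtain ⟨h34, h45⟩ := rg11_three_four_eq_zero_and_four_five_eq_zero hD
  have hlt' : i + (i + 1) < 11 := hlt
  obtain rfl | rfl : i = 3 ∨ i = 4 := by omega
  · exact h34
  · exact h45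

section Rg3

open GradedTable

variable (n : ℕ)

theorem hasGradingElement_rg3 : (Rg3 n).HasGradingElement := fun i => by
  rcases i with _ | i <;> simp [coeff, Rg3]

theorem rg3_coeff_one_two : (Rg3 n).coeff 1 2 = 0 := by
  simp [coeff, Rg3]

theorem rg3_coeff_one {j : ℕ} (hj : 3 ≤ j) : (Rg3 n).coeff 1 j = 1 := by
  obtain ⟨j, rfl⟩ := Nat.exists_eq_add_of_le' hj
  simp [coeff, Rg3]

theorem rg3_coeff_two {j : ℕ} (hj : 3 ≤ j) : (Rg3 n).coeff 2 j = -1 := by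
  obtain ⟨j, rfl⟩ := Nat.exists_eq_add_of_le' hj
  simp [coeff, Rg3]

theorem rg3_coeff_three {j : ℕ} (hj : 4 ≤ j) : (Rg3 n).coeff 3 j = 1 := by
  obtain ⟨j, rfl⟩ := Nat.exists_eq_add_of_le' hj
  simp [coeff, Rg3]

theorem rg3_coeff_eq_zero {i j : ℕ} (hi : 4 ≤ i) (hj : 4 ≤ j) : (Rg3 n).coeff i j = 0 := by
  obtain ⟨i, rfl⟩ := Nat.exists_eq_add_of_le' hi
  obtain ⟨j, rfl⟩ := Nat.exists_eq_add_of_le' hj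
  simp [coeff, Rg3]

theorem alternation_rg3Values_zero (j : ℕ) : alternation rg3Values 0 j = 0 := by
  simp [alternation, rg3Values]

theorem alternation_rg3Values_one_two : alternation rg3Values 1 2 = 1 := by
  simp [alternation, rg3Values]

theorem alternation_rg3Values_one {j : ℕ} (hj : 3 ≤ j) : alternation rg3Values 1 j = 0 := by
  obtain ⟨j, rfl⟩ := Nat.exists_eq_add_of_le' hj
  simp [alternation, rg3Values]

theorem alternation_rg3Values_two_three : alternation rg3Values 2 3 = 0 := by
  simp [alternation, rg3Values]

theorem alternation_rg3Values_two {j : ℕ} (hj : 4 ≤ j) : alternation rg3Values 2 j = 4 - j := by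
  rcases hj.eq_or_lt with rfl | hj
  · simp [alternation, rg3Values]
  · obtain ⟨j, rfl⟩ := Nat.exists_eq_add_of_le' hj
    simp [alternation, rg3Values]

theorem alternation_rg3Values_three_four : alternation rg3Values 3 4 = 0 := by
  simp [alternation, rg3Values]

theorem alternation_rg3Values_three {j : ℕ} (hj : 5 ≤ j) :
    alternation rg3Values 3 j = 3 / 2 * (j - 5) := by
  rcases hj.eq_or_lt with rfl | hj
  · simp [alternation, rg3Values]
  · obtain ⟨j, rfl⟩ := Nat.exists_eq_add_of_le' hj
    simp [alternation, rg3Values]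

theorem alternation_rg3Values_four {j : ℕ} (hj : 5 ≤ j) :
    alternation rg3Values 4 j = -3 / 2 := by
  obtain ⟨j, rfl⟩ := Nat.exists_eq_add_of_le' hj
  simp [alternation, rg3Values]

theorem alternation_rg3Values_eq_zero {i j : ℕ} (hi : 5 ≤ i) (hj : 5 ≤ j) :
    alternation rg3Values i j = 0 := by
  obtain ⟨i, rfl⟩ := Nat.exists_eq_add_of_le' hi
  obtain ⟨j, rfl⟩ := Nat.exists_eq_add_of_le' hj
  simp [alternation, rg3Values]

theorem rg3_coboundaryCoeff_zero (j k : ℕ) :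
    coboundaryCoeff (Rg3 n).coeff (alternation rg3Values) 0 j k = 0 := by
  have hrow := alternation_rg3Values_zero
  rw [coboundaryCoeff_of_row_eq_zero (Rg3 n).coeff_skew (alternation_skew _) (hrow j) (hrow k)
    (hrow _), (Rg3 n).coeff_skew, (Rg3 n).coeff_skew 0 j, (Rg3 n).coeff_skew 0 k]
  simp only [hasGradingElement_rg3 n _, zero_add, Nat.cast_add]
  ring

theorem rg3_coboundaryCoeff_one_two {k : ℕ} (hk : 3 ≤ k) :
    coboundaryCoeff (Rg3 n).coeff (alternation rg3Values) 1 2 k = 0 := by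
  rw [coboundaryCoeff, rg3_coeff_one n (by omega : 3 ≤ 2 + k), (Rg3 n).coeff_skew k (1 + 2),
    rg3_coeff_one_two, (Rg3 n).coeff_skew k 1, rg3_coeff_one n hk, alternation_skew _ k 1,
    alternation_rg3Values_one hk, alternation_rg3Values_one_two,
    alternation_rg3Values_one (by omega : 3 ≤ 2 + k),
    alternation_rg3Values_two (by omega : 4 ≤ k + 1)]
  rcases hk.eq_or_lt with rfl | hk
  · rw [self_eq_neg.1 ((Rg3 n).coeff_skew 3 3), alternation_rg3Values_two_three]
    push_cast
    ring
  · rw [rg3_coeff_three n hk, alternation_rg3Values_two hk]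
    push_cast
    ring

theorem rg3_coboundaryCoeff_one {j k : ℕ} (hj : 3 ≤ j) (hk : j < k) :
    coboundaryCoeff (Rg3 n).coeff (alternation rg3Values) 1 j k = 0 := by
  rw [coboundaryCoeff_of_row_eq_zero (Rg3 n).coeff_skew (alternation_skew _)
    (alternation_rg3Values_one hj) (alternation_rg3Values_one (by omega : 3 ≤ k))
    (alternation_rg3Values_one (by omega)), rg3_coeff_one n (by omega : 3 ≤ j + k),
    rg3_coeff_one n hj, rg3_coeff_one n (by omega : 3 ≤ k)]
  rcases (show j = 3 ∧ k = 4 ∨ j = 3 ∧ 5 ≤ k ∨ j = 4 ∨ 5 ≤ j by omega) with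
    ⟨rfl, rfl⟩ | ⟨rfl, hk5⟩ | rfl | hj
  · rw [alternation_rg3Values_three_four, self_eq_neg.1 (alternation_skew _ (1 + 3) 4),
      alternation_rg3Values_three (by omega)]
    push_cast
    ring
  · rw [alternation_rg3Values_three hk5, alternation_rg3Values_four hk5,
      alternation_rg3Values_three (by omega)]
    push_cast
    ring
  · rw [alternation_rg3Values_four hk, alternation_rg3Values_eq_zero (by omega) hk,
      alternation_rg3Values_four (by omega)]
    ring
  · rw [alternation_rg3Values_eq_zero hj (by omega), alternation_rg3Values_eq_zero (by omega)
      (by omega), alternation_rg3Values_eq_zero hj (by omega)]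
    ring

theorem rg3_coboundaryCoeff_two_three {k : ℕ} (hk : 4 ≤ k) :
    coboundaryCoeff (Rg3 n).coeff (alternation rg3Values) 2 3 k = 0 := by
  rw [coboundaryCoeff, rg3_coeff_two n (by omega : 3 ≤ 3 + k),
    rg3_coeff_three n (by omega : 4 ≤ k + 2), rg3_coeff_eq_zero n hk (by omega),
    rg3_coeff_three n hk, (Rg3 n).coeff_skew k 2, rg3_coeff_two n (by omega : 3 ≤ k),
    rg3_coeff_two n le_rfl, alternation_skew _ k 2, alternation_rg3Values_two hk,
    alternation_rg3Values_two (by omega : 4 ≤ 3 + k),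
    alternation_rg3Values_three (by omega : 5 ≤ k + 2)]
  rcases hk.eq_or_lt with rfl | hk
  · rw [alternation_rg3Values_three_four, alternation_rg3Values_four (by omega : 5 ≤ 2 + 3)]
    push_cast
    ring
  · rw [alternation_rg3Values_three hk, alternation_rg3Values_eq_zero hk le_rfl]
    push_cast
    ring

theorem rg3_coboundaryCoeff_two {j k : ℕ} (hj : 4 ≤ j) (hk : j < k) :
    coboundaryCoeff (Rg3 n).coeff (alternation rg3Values) 2 j k = 0 := by
  rw [coboundaryCoeff, rg3_coeff_two n (by omega : 3 ≤ j + k),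
    rg3_coeff_eq_zero n hj (by omega : 4 ≤ k + 2), rg3_coeff_eq_zero n (by omega) (by omega),
    rg3_coeff_eq_zero n hj (by omega : 4 ≤ k), (Rg3 n).coeff_skew k 2,
    rg3_coeff_two n (by omega : 3 ≤ k), rg3_coeff_two n (by omega : 3 ≤ j),
    alternation_rg3Values_eq_zero (by omega : 5 ≤ k) (by omega : 5 ≤ 2 + j)]
  rcases hj.eq_or_lt with rfl | hj
  · rw [alternation_rg3Values_four hk, alternation_rg3Values_four (by omega)]
    ring
  · rw [alternation_rg3Values_eq_zero hj (by omega), alternation_rg3Values_eq_zero hj (by omega)]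
    ring

theorem rg3_coboundaryCoeff_three {j k : ℕ} (hj : 4 ≤ j) (hk : j < k) :
    coboundaryCoeff (Rg3 n).coeff (alternation rg3Values) 3 j k = 0 := by
  rw [coboundaryCoeff, rg3_coeff_three n (by omega : 4 ≤ j + k),
    rg3_coeff_eq_zero n hj (by omega : 4 ≤ k + 3), rg3_coeff_eq_zero n (by omega) (by omega),
    rg3_coeff_eq_zero n hj (by omega : 4 ≤ k), (Rg3 n).coeff_skew k 3,
    rg3_coeff_three n (by omega : 4 ≤ k), rg3_coeff_three n hj,
    alternation_rg3Values_eq_zero (by omega : 5 ≤ k) (by omega : 5 ≤ 3 + j)]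
  rcases hj.eq_or_lt with rfl | hj
  · rw [alternation_rg3Values_four hk, alternation_rg3Values_four (by omega)]
    ring
  · rw [alternation_rg3Values_eq_zero hj (by omega), alternation_rg3Values_eq_zero hj (by omega)]
    ring

theorem rg3_coboundaryCoeff_of_four_le (C : ℕ → ℕ → ℂ) {i j k : ℕ} (hi : 4 ≤ i) (hj : 4 ≤ j)
    (hk : 4 ≤ k) : coboundaryCoeff (Rg3 n).coeff C i j k = 0 := by
  have hc (a b : ℕ) (ha : 4 ≤ a) (hb : 4 ≤ b) := rg3_coeff_eq_zero n ha hb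
  rw [coboundaryCoeff, hc i (j + k) hi (by omega), hc j (k + i) hj (by omega),
    hc k (i + j) hk (by omega), hc j k hj hk, hc k i hk hi, hc i j hi hj]
  ring

theorem isCocycle_rg3Values : (Rg3 n).IsCocycle (alternation rg3Values) := by
  refine ⟨alternation_skew _, coboundaryCoeff_eq_zero_of_lt (Rg3 n).coeff_skew (alternation_skew _)
    fun i j k hij hjk _ => ?_⟩
  rcases (show i = 0 ∨ i = 1 ∧ j = 2 ∨ i = 1 ∧ 3 ≤ j ∨ i = 2 ∧ j = 3 ∨ i = 2 ∧ 4 ≤ j ∨ i = 3 ∨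
    4 ≤ i by omega) with rfl | ⟨rfl, rfl⟩ | ⟨rfl, hj⟩ | ⟨rfl, rfl⟩ | ⟨rfl, hj⟩ | rfl | hi
  · exact rg3_coboundaryCoeff_zero n j k
  · exact rg3_coboundaryCoeff_one_two n hjk
  · exact rg3_coboundaryCoeff_one n hj hjk
  · exact rg3_coboundaryCoeff_two_three n hjk
  · exact rg3_coboundaryCoeff_two n hj hjk
  · exact rg3_coboundaryCoeff_three n hij hjk
  · exact rg3_coboundaryCoeff_of_four_le n _ hi (by omega) (by omega)

end Rg3

section Rg3Vanishing

open GradedTable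

/-- The normal form, modulo coboundaries of diagonal maps, of the cocycles of `Rg3 n` with
`C 1 2 = 0`. -/
structure IsRg3Normalized (n : ℕ) (C : ℕ → ℕ → ℂ) : Prop extends (Rg3 n).IsCocycle C where
  zero_one : C 0 1 = 0
  one_row : ∀ j, 2 ≤ j → 1 + j ≤ n → C 1 j = 0
  two_three : C 2 3 = 0
  three_four : C 3 4 = 0

variable {n : ℕ} {C : ℕ → ℕ → ℂ}

/-- The weights `a_j` of `v_j` are determined from `a_1 = 0` along the brackets
`[v_1, v_j] = v_{j+1}` for `j ≥ 3`, `[v_2, v_3] = -v_5` and `[v_3, v_4] = v_7`. -/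
theorem exists_isRg3Normalized_sub_diagCoboundary (hC : (Rg3 n).IsCocycle C) (h : C 1 2 = 0) :
    ∃ a, IsRg3Normalized n fun i j => C i j - (Rg3 n).diagCoboundary a i j := by
  let a : ℕ → ℂ
    | 0 => -C 0 1
    | 1 => 0
    | 2 => -C 2 3 - C 1 3 - C 1 4
    | m + 3 => C 3 4 - C 1 4 - C 1 5 - C 1 6 - ∑ t ∈ Finset.range m, C 1 (t + 3)
  have a_succ (j : ℕ) (hj : 3 ≤ j) : a (1 + j) = a j - C 1 j := by
    obtain ⟨m, rfl⟩ := Nat.exists_eq_add_of_le' hj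
    simp only [a, show 1 + (m + 3) = m + 1 + 3 by omega, Finset.sum_range_succ]
    ring
  have a_four : a 4 = a 3 - C 1 3 := a_succ 3 le_rfl
  have a_five : a 5 = a 4 - C 1 4 := a_succ 4 (by decide)
  have a_six : a 6 = a 5 - C 1 5 := a_succ 5 (by decide)
  have a_seven : a 7 = a 6 - C 1 6 := a_succ 6 (by decide)
  have a_three : a 3 = C 3 4 - C 1 4 - C 1 5 - C 1 6 := sub_zero _
  refine ⟨a, hC.sub (isCocycle_diagCoboundary a), ?_, fun j h2 hj => ?_, ?_, ?_⟩
  · rw [diagCoboundary, (Rg3 n).coeff_skew, hasGradingElement_rg3]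
    simp only [a, Nat.cast_one]
    ring
  · rw [diagCoboundary]
    rcases h2.eq_or_lt with rfl | h3
    · rw [h, rg3_coeff_one_two, zero_mul, sub_zero]
    · rw [rg3_coeff_one n h3, a_succ j h3]
      simp only [a]
      ring
  · rw [diagCoboundary, rg3_coeff_two n le_rfl, a_five, a_four]
    simp only [a]
    ring
  · rw [diagCoboundary, rg3_coeff_three n le_rfl, a_seven, a_six, a_five, a_four, a_three]
    ring

namespace IsRg3Normalized

theorem row_zero_eq_zero (hC : IsRg3Normalized n C) (hn : 7 ≤ n) {j : ℕ} (hj : j ≤ n) :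
    C 0 j = 0 := by
  have add {i j : ℕ} (h : i + j ≤ n) (hc : (Rg3 n).coeff i j ≠ 0) :
      C 0 (i + j) = C 0 i + C 0 j := hC.row_zero_add (hasGradingElement_rg3 n) h hc
  have const (j : ℕ) (h3 : 3 ≤ j) (hj : j ≤ n) : C 0 j = C 0 3 := by
    induction j, h3 using Nat.le_induction with
    | base => rfl
    | succ j h3 ih =>
      rw [add_comm, add (by omega) (by simp [rg3_coeff_one n h3]), hC.zero_one, zero_add,
        ih (by omega)]
  have three : C 0 3 = 0 := by
    have h7 := add (i := 3) (j := 4) hn (by simp [rg3_coeff_three])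
    rwa [const _ (by omega) hn, const 4 (by omega) (by omega), left_eq_add] at h7
  have two : C 0 2 = 0 := by
    have h5 := add (i := 2) (j := 3) (by omega) (by simp [rg3_coeff_two])
    rwa [const _ (by omega) (by omega), right_eq_add] at h5
  rcases (show j = 0 ∨ j = 1 ∨ j = 2 ∨ 3 ≤ j by omega) with rfl | rfl | rfl | h3
  · exact hC.self_eq_zero 0
  · exact hC.zero_one
  · exact two
  · rw [const j h3 hj, three]

theorem row_two_eq_zero (hC : IsRg3Normalized n C) {j : ℕ} (h3 : 3 ≤ j) (hj : 2 + j ≤ n) :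
    C 2 j = 0 := by
  induction j, h3 using Nat.le_induction with
  | base => exact hC.two_three
  | succ j h3 ih =>
    have hrec := hC.recursion_of_row_eq_zero (m := 1) (i := 2) (j := j) (by change _ ≤ n; omega)
      (hC.one_row 2 le_rfl (by omega)) (hC.one_row j (by omega) (by omega))
      (hC.one_row (2 + j) (by omega) (by omega))
    rw [rg3_coeff_one_two, rg3_coeff_one n h3, ih (by omega), mul_zero, zero_mul, zero_add,
      one_mul, add_comm 1 j] at hrec
    exact hrec.symm

theorem pascal (hC : IsRg3Normalized n C) {i j : ℕ} (hi : 3 ≤ i) (hj : 3 ≤ j)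
    (h : i + j + 1 ≤ n) : C i j = C (i + 1) j + C i (j + 1) := by
  have hrec := hC.recursion_of_row_eq_zero (by change 1 + i + j ≤ n; omega)
    (hC.one_row i (by omega) (by omega)) (hC.one_row j (by omega) (by omega))
    (hC.one_row (i + j) (by omega) (by omega))
  rwa [rg3_coeff_one n (by omega), rg3_coeff_one n hi, rg3_coeff_one n hj, one_mul, one_mul,
    one_mul, add_comm 1 i, add_comm 1 j] at hrec

theorem pascal_two (hC : IsRg3Normalized n C) {i j : ℕ} (hi : 3 ≤ i) (hj : 3 ≤ j)
    (h : i + j + 2 ≤ n) : C i j = C (i + 2) j + C i (j + 2) := by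
  have hrec := hC.recursion_of_row_eq_zero (by change 2 + i + j ≤ n; omega)
    (hC.row_two_eq_zero hi (by omega)) (hC.row_two_eq_zero hj (by omega))
    (hC.row_two_eq_zero (by omega) (by omega))
  rw [rg3_coeff_two n (by omega), rg3_coeff_two n hi, rg3_coeff_two n hj, add_comm 2 i,
    add_comm 2 j] at hrec
  linear_combination -hrec

/-- Applying `pascal` twice and comparing with `pascal_two` leaves the middle binomial term. -/
theorem eq_zero_of_four_le (hC : IsRg3Normalized n C) {i j : ℕ} (hi : 4 ≤ i) (hj : 4 ≤ j)
    (h : i + j ≤ n) : C i j = 0 := by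
  obtain ⟨i, rfl⟩ := Nat.exists_eq_add_of_le' hi
  obtain ⟨j, rfl⟩ := Nat.exists_eq_add_of_le' hj
  have h₀ := hC.pascal (i := i + 3) (j := j + 3) (by omega) (by omega) (by omega)
  have h₁ := hC.pascal (i := i + 4) (j := j + 3) (by omega) (by omega) (by omega)
  have h₂ := hC.pascal (i := i + 3) (j := j + 4) (by omega) (by omega) (by omega)
  have h₃ := hC.pascal_two (i := i + 3) (j := j + 3) (by omega) (by omega) (by omega)
  linear_combination (h₃ - h₀ - h₁ - h₂) / 2

theorem eq_zero (hC : IsRg3Normalized n C) (hn : 7 ≤ n) {i j : ℕ} (hij : i + j ≤ n) :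
    C i j = 0 := by
  refine hC.eq_zero_of_forall_lt (fun i j hlt hij => ?_) hij
  change i + j ≤ n at hij
  rcases (show i = 0 ∨ i = 1 ∨ i = 2 ∨ 3 ≤ i by omega) with rfl | rfl | rfl | hi
  · exact hC.row_zero_eq_zero hn (by omega)
  · exact hC.one_row j hlt hij
  · exact hC.row_two_eq_zero hlt hij
  refine eq_zero_of_pascal (C := C) hC.self_eq_zero (fun i hi h => ?_)
    (fun i j hi hlt h => hC.pascal hi (by omega) (by omega)) hi hlt.le hij
  rcases hi.eq_or_lt with rfl | hi
  · exact hC.three_four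
  · exact hC.eq_zero_of_four_le hi (by omega) h

end IsRg3Normalized

theorem rg3_exists_eq_diagCoboundary (hn : 7 ≤ n) (hC : (Rg3 n).IsCocycle C) (h : C 1 2 = 0) :
    ∃ a, ∀ i j, i + j ≤ n → C i j = (Rg3 n).diagCoboundary a i j := by
  obtain ⟨a, hD⟩ := exists_isRg3Normalized_sub_diagCoboundary hC h
  exact ⟨a, fun i j hij => sub_eq_zero.1 (hD.eq_zero hn hij)⟩

end Rg3Vanishing

end

theorem mainTheorem10 :
    (∀ n : ℕ, 7 ≤ n →
      (∀ (R : Type*) [LieRing R] [LieAlgebra ℂ R], Nonempty (R ≃ₗ⁅ℂ⁆ (Rg3 n).Alg) →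
        Module.finrank ℂ (LieH2 ℂ R R) = 1) ∧
      (Rg3 n).cochain rg3Values ∈ twoCocycle ℂ (Rg3 n).Alg (Rg3 n).Alg ∧
      (Rg3 n).cochain rg3Values ∉ LinearMap.range (d₁₂ ℂ (Rg3 n).Alg (Rg3 n).Alg)) ∧
    ((∀ (R : Type*) [LieRing R] [LieAlgebra ℂ R], Nonempty (R ≃ₗ⁅ℂ⁆ Rg7.Alg) →
        Module.finrank ℂ (LieH2 ℂ R R) = 1) ∧
      Rg7.cochain rg7Values ∈ twoCocycle ℂ Rg7.Alg Rg7.Alg ∧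
      Rg7.cochain rg7Values ∉ LinearMap.range (d₁₂ ℂ Rg7.Alg Rg7.Alg)) ∧
    ((∀ (R : Type*) [LieRing R] [LieAlgebra ℂ R], Nonempty (R ≃ₗ⁅ℂ⁆ Rg9.Alg) →
        Module.finrank ℂ (LieH2 ℂ R R) = 1) ∧
      Rg9.cochain rg9Values ∈ twoCocycle ℂ Rg9.Alg Rg9.Alg ∧
      Rg9.cochain rg9Values ∉ LinearMap.range (d₁₂ ℂ Rg9.Alg Rg9.Alg)) ∧
    ((∀ (R : Type*) [LieRing R] [LieAlgebra ℂ R], Nonempty (R ≃ₗ⁅ℂ⁆ Rg11.Alg) →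
        Module.finrank ℂ (LieH2 ℂ R R) = 1) ∧
      Rg11.cochain rg11Values ∈ twoCocycle ℂ Rg11.Alg Rg11.Alg ∧
      Rg11.cochain rg11Values ∉ LinearMap.range (d₁₂ ℂ Rg11.Alg Rg11.Alg)) := by
  refine ⟨fun n hn => ?_, ?_, ?_, ?_⟩
  · exact (hasGradingElement_rg3 n).finrank_lieH2_eq_one_and_cochain_mem_and_notMem
      (isCocycle_rg3Values n) 1 2 (by change 1 + 2 ≤ n; omega) (rg3_coeff_one_two n)
      (by decide +kernel) fun _ hC h => rg3_exists_eq_diagCoboundary hn hC h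
  · exact isQFiliform_rg7.hasGradingElement.finrank_lieH2_eq_one_and_cochain_mem_and_notMem
      isCocycle_rg7Values 1 6 (by decide) isQFiliform_rg7.coeff_one_top (by decide +kernel)
      fun _ hC h => rg7_exists_eq_diagCoboundary hC h
  · exact isQFiliform_rg9.hasGradingElement.finrank_lieH2_eq_one_and_cochain_mem_and_notMem
      isCocycle_rg9Values 1 8 (by decide) isQFiliform_rg9.coeff_one_top (by decide +kernel)
      fun _ hC h => rg9_exists_eq_diagCoboundary hC h
  · exact isQFiliform_rg11.hasGradingElement.finrank_lieH2_eq_one_and_cochain_mem_and_notMem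
      isCocycle_rg11Values 1 10 (by decide) isQFiliform_rg11.coeff_one_top (by decide +kernel)
      fun _ hC h => rg11_exists_eq_diagCoboundary hC h
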